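/- **Setting.** Fix $t\in\mathbb N$ and $g\in\mathbb R$ with $g+\tfrac12>0$, and let $$\mathrm{Fact}(m)=\sqrt{2\pi}\,(m+g+\tfrac12)^{m+1/2}e^{-(m+g+1/2)}A_{t,g}(m)$$ be the Lanczos approximation of $m!$, where $A_{t,g}$ is the truncation to $t$ terms of Lanczos' series $\tfrac12p_0(g)+p_1(g)\frac{m}{m+1}+p_2(g)\frac{m(m-1)}{(m+1)(m+2)}+\cdots$, $p_j(g)=\frac{\sqrt2}{\pi}\sum_{l=0}^{j}[X^{2l}]T_{2j}\,\Gamma(l+\tfrac12)(l+g+\tfrac12)^{-(l+1/2)}e^{l+g+1/2}$, with $T_i$ the Chebyshev polynomials of the first kind. Let $\zeta=\sup_{m\in\mathbb N}|m!-\mathrm{Fact}(m)|/m!$ be its uniform relative error and suppose $\zeta<\tfrac13$. For a working precision $\beta$ let $\varepsilon=2^{-\beta}$, let $\mathrm{rnd}$ be a rounding of the reals to nearest (ties broken arbitrarily) in $\{0\}\cup\{w2^e: e\in\mathbb Z,\ \tfrac12\le|w|\le1,\ 2^\beta w\in\mathbb Z\}$, and put $x\circledast y=\mathrm{rnd}(\mathrm{rnd}(x)*\mathrm{rnd}(y))$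 for $*\in\{+,-,\times,/\}$, and similarly for $\sqrt{\ }$. For $x=w2^e>0$ with $\tfrac12\le w<1$ let $\mathrm{Log}(x)=\frac{\pi}{2\,\mathrm{AGM}(1,4/s)}-m\log2$, where $m=\lceil(\beta+3)/2\rceil-e$, $s=x2^m$ and $\mathrm{AGM}$ is the arithmetic-geometric mean. Let $$\mathrm{LogFactorial}(m)=\tfrac12\mathrm{Log}(2\pi)+(m+\tfrac12)\mathrm{Log}(m+g+\tfrac12)-(m+g+\tfrac12)+\mathrm{Log}(A_{t,g}(m)).$$ Let $b_{n,p}(k)=\binom nk p^k(1-p)^{n-k}$ with $0<p<1$. A hat distribution with rejection rate $\alpha>0$ is a probability distribution $h$ on $\mathbb Z$ with $b_{n,p}(k)\le\alpha h(k)$ for $0\le k\le n$. When $k$ is drawn, BinSamp computes $h^{-1}(u)=1/h(k)$ by a finite sequence of basic operations, each rounded as above, and then, from left to right, $$l_v=l_n\ominus l_k\ominus l_{n-k}\oplus k\otimes\mathrm{Log}(p)\oplus(n-k)\otimes\mathrm{Log}(1-p)\oplus\mathrm{Log}(h^{-1}(u))\ominus\mathrm{Log}(\alpha),\qquad l_m=\mathrm{LogFactorial}(m),$$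 where $h^{-1}(u)$ stands for its computed value. The computed rejection ratio is $\widetilde r_k=e^{l_v}$; the exact one is $r_k=\frac{b_{n,p}(k)}{\alpha h(k)}$. The computation of $h^{-1}(u)$ is assumed admissible with a constant $c>0$, a condition on exact values only: no division by zero or root of a negative number occurs, no sum or difference is zero, and every operation in it has first-order error amplification at most $c$. Here the amplification $\kappa$ is $0$ for an input that is representable in precision $\beta$ and $1$ for any other input; $\kappa(x\pm y)=\frac{|x|\kappa(x)+|y|\kappa(y)}{|x\pm y|}+1$; $\kappa(xy)=\kappa(x/y)=\kappa(x)+\kappa(y)+1$; $\kappa(\sqrt x)=\kappa(x)+1$. **Statement.** For all $t,g,\alpha,c$ as above there is a function $R(\beta)=o(\varepsilon)$ as $\beta\to\infty$, depending only on $t,g,\alpha,c$, such that for all sufficiently large $\beta$ (again depending only on $t,g,\alpha,c$) the following holds. For all $n\in\mathbb N$ and $p\in(0,1)$ with $\beta\ge\max(2\lceil\log_2n\rceil,\lceil-\log_2p\rceil,\lceil-\log_2(1-p)\rceil)$ (the first term being dropped if $n=0$), every hat distribution $h$ with rejection rate $\alpha$, every rounding to nearest, every $k\in[0,n]$ and every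 admissible computation of $1/h(k)$ with constant $c$, $$\left|\frac{\widetilde r_k}{r_k}-1\right|\le(1110n+2540)\,\beta\varepsilon+14\,\varepsilon\log h(k)+15\,\zeta+R(\beta).$$ -/

import Mathlib

namespace BinSamp

noncomputable section

/-! ### Floating-point numbers of precision `β` -/

/-- The unit round-off `ε = 2^{-β}` of working precision `β`. -/
def unitRoundoff (β : ℕ) : ℝ := 1 / 2 ^ β

/-- The numbers of working precision `β`: zero and all `w · 2^e` with `e ∈ ℤ` and a significand
`w` with `1/2 ≤ |w| ≤ 1` that is an integer multiple of `2^{-β}` (so that `ulp = 2^{e-β}`). -/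
def floats (β : ℕ) : Set ℝ :=
  {x | x = 0 ∨ ∃ (w : ℝ) (e : ℤ), 1 / 2 ≤ |w| ∧ |w| ≤ 1 ∧ (∃ m : ℤ, w * 2 ^ β = m) ∧
    x = w * 2 ^ e}

/-- `rnd` rounds every real number to a nearest number of precision `β`; ties may be broken in
any way. -/
def IsRoundToNearest (β : ℕ) (rnd : ℝ → ℝ) : Prop :=
  ∀ x : ℝ, rnd x ∈ floats β ∧ ∀ y ∈ floats β, |rnd x - x| ≤ |y - x|

/-- Floating-point addition `x ⊕ y`. -/
def flAdd (rnd : ℝ → ℝ) (x y : ℝ) : ℝ := rnd (rnd x + rnd y)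

/-- Floating-point subtraction `x ⊖ y`. -/
def flSub (rnd : ℝ → ℝ) (x y : ℝ) : ℝ := rnd (rnd x - rnd y)

/-- Floating-point multiplication `x ⊗ y`. -/
def flMul (rnd : ℝ → ℝ) (x y : ℝ) : ℝ := rnd (rnd x * rnd y)

/-- Floating-point division. -/
def flDiv (rnd : ℝ → ℝ) (x y : ℝ) : ℝ := rnd (rnd x / rnd y)

/-- Floating-point square root. -/
def flSqrt (rnd : ℝ → ℝ) (x : ℝ) : ℝ := rnd (Real.sqrt (rnd x))

/-! ### Evaluation of the inverse hat function by basic operations -/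

/-- A computation that uses only the basic operations `+, -, ×, /, √`, with real inputs at the
leaves (constants, parameters such as `n` and `p`, the random number `u`, …). -/
inductive ArithExpr : Type
  | input (r : ℝ) : ArithExpr
  | add (x y : ArithExpr) : ArithExpr
  | sub (x y : ArithExpr) : ArithExpr
  | mul (x y : ArithExpr) : ArithExpr
  | div (x y : ArithExpr) : ArithExpr
  | sqrt (x : ArithExpr) : ArithExpr

namespace ArithExpr

/-- The exact value. -/
def val : ArithExpr → ℝ
  | input r => r
  | add x y => x.val + y.val
  | sub x y => x.val - y.val
  | mul x y => x.val * y.val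
  | div x y => x.val / y.val
  | sqrt x => Real.sqrt x.val

/-- The value computed in floating-point arithmetic. -/
def flVal (rnd : ℝ → ℝ) : ArithExpr → ℝ
  | input r => rnd r
  | add x y => flAdd rnd (x.flVal rnd) (y.flVal rnd)
  | sub x y => flSub rnd (x.flVal rnd) (y.flVal rnd)
  | mul x y => flMul rnd (x.flVal rnd) (y.flVal rnd)
  | div x y => flDiv rnd (x.flVal rnd) (y.flVal rnd)
  | sqrt x => flSqrt rnd (x.flVal rnd)

open Classical in
/-- The first-order amplification of the unit round-off: how many units `ε` of relative error the
exact data of the computation allow it to accumulate. Each operation contributes one unit; an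
input contributes one unit unless it is representable; a sum or difference weighs the errors of
its operands by their sizes relative to the result. -/
def amp (β : ℕ) : ArithExpr → ℝ
  | input r => if r ∈ floats β then 0 else 1
  | add x y => (|x.val| * x.amp β + |y.val| * y.amp β) / |x.val + y.val| + 1
  | sub x y => (|x.val| * x.amp β + |y.val| * y.amp β) / |x.val - y.val| + 1
  | mul x y => x.amp β + y.amp β + 1
  | div x y => x.amp β + y.amp β + 1
  | sqrt x => x.amp β + 1

/-- Every operation of the computation is well defined (no division by zero, no root of a negative
number), no sum or difference cancels to zero, and the amplification stays below `c` throughout.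
All conditions are on exact values; none is on computed values. -/
def Admissible (β : ℕ) (c : ℝ) : ArithExpr → Prop
  | input _ => True
  | add x y => x.Admissible β c ∧ y.Admissible β c ∧ x.val + y.val ≠ 0 ∧ (add x y).amp β ≤ c
  | sub x y => x.Admissible β c ∧ y.Admissible β c ∧ x.val - y.val ≠ 0 ∧ (sub x y).amp β ≤ c
  | mul x y => x.Admissible β c ∧ y.Admissible β c ∧ (mul x y).amp β ≤ c
  | div x y => x.Admissible β c ∧ y.Admissible β c ∧ y.val ≠ 0 ∧ (div x y).amp β ≤ c
  | sqrt x => x.Admissible β c ∧ 0 ≤ x.val ∧ (sqrt x).amp β ≤ c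

end ArithExpr

/-! ### Approximate logarithm -/

/-- The exponent `e` of `x = w · 2^e > 0` with `1/2 ≤ w < 1`. -/
def exponent (x : ℝ) : ℤ := Int.log 2 x + 1

/-- The shift `m = ⌈(β + 3) / 2⌉ - exponent x`. -/
def logShift (β : ℕ) (x : ℝ) : ℤ := ⌈((β : ℝ) + 3) / 2⌉ - exponent x

/-- The logarithm computed by the arithmetic-geometric mean:
`Log x = π / (2 AGM(1, 4/s)) - m log 2` with `s = x · 2^m`. -/
def agmLog (β : ℕ) (x : ℝ) : ℝ :=
  Real.pi / (2 * (NNReal.agm 1 (Real.toNNReal (4 / (x * 2 ^ logShift β x))) : ℝ))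
    - logShift β x * Real.log 2

/-! ### Lanczos approximation of the factorial -/

/-- Lanczos' coefficient
`p_j(g) = (√2/π) ∑_{l ≤ j} [X^{2l}]T_{2j} · Γ(l+1/2) · (l+g+1/2)^{-(l+1/2)} · e^{l+g+1/2}`,
with `T_{2j}` the Chebyshev polynomial of the first kind. -/
def lanczosCoeff (g : ℝ) (j : ℕ) : ℝ :=
  Real.sqrt 2 / Real.pi * ∑ l ∈ Finset.range (j + 1),
    (Polynomial.Chebyshev.T ℝ (2 * (j : ℤ))).coeff (2 * l) * Real.Gamma ((l : ℝ) + 1 / 2) *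
      ((l : ℝ) + g + 1 / 2) ^ (-((l : ℝ) + 1 / 2)) * Real.exp ((l : ℝ) + g + 1 / 2)

/-- The first `t` terms of Lanczos' series
`A_g(m) = p_0/2 + p_1 m/(m+1) + p_2 m(m-1)/((m+1)(m+2)) + ⋯`. -/
def lanczosSeries (t : ℕ) (g : ℝ) (m : ℕ) : ℝ :=
  ∑ j ∈ Finset.range t, (if j = 0 then 1 / 2 else 1) * lanczosCoeff g j *
    ∏ i ∈ Finset.range j, ((m : ℝ) - i) / ((m : ℝ) + i + 1)

/-- The Lanczos approximation of `m!`. -/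
def factLanczos (t : ℕ) (g : ℝ) (m : ℕ) : ℝ :=
  Real.sqrt (2 * Real.pi) * ((m : ℝ) + g + 1 / 2) ^ ((m : ℝ) + 1 / 2) *
    Real.exp (-((m : ℝ) + g + 1 / 2)) * lanczosSeries t g m

/-- The uniform bound `ζ` on the relative error of the Lanczos approximation,
`ζ = sup_m |m! - Fact(m)| / m!`, as an extended nonnegative real. -/
def lanczosError (t : ℕ) (g : ℝ) : ENNReal :=
  ⨆ m : ℕ, ENNReal.ofReal (|(m.factorial : ℝ) - factLanczos t g m| / (m.factorial : ℝ))

/-- `LogFactorial(m)`: the logarithm of the Lanczos approximation, with `Log` in place of `log`. -/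
def logFactorial (β t : ℕ) (g : ℝ) (m : ℕ) : ℝ :=
  1 / 2 * agmLog β (2 * Real.pi) + ((m : ℝ) + 1 / 2) * agmLog β ((m : ℝ) + g + 1 / 2)
    - ((m : ℝ) + g + 1 / 2) + agmLog β (lanczosSeries t g m)

/-! ### The rejection ratio -/

/-- The binomial probability `b_{n,p}(k)`. -/
def binomialMass (n : ℕ) (p : ℝ) (k : ℕ) : ℝ := n.choose k * p ^ k * (1 - p) ^ (n - k)

/-- `h` is a hat distribution for the binomial distribution with rejection rate `α`: a probability
distribution on the integers such that `α h` dominates the binomial probabilities. -/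
structure IsHat (n : ℕ) (p α : ℝ) (h : ℤ → ℝ) : Prop where
  nonneg : ∀ i, 0 ≤ h i
  hasSum_one : HasSum h 1
  dominates : ∀ k : ℕ, k ≤ n → binomialMass n p k ≤ α * h k

/-- The exact rejection ratio `r_k = b_{n,p}(k) / (α h(k))`. -/
def rejectionRatio (n : ℕ) (p α : ℝ) (h : ℤ → ℝ) (k : ℕ) : ℝ :=
  binomialMass n p k / (α * h k)

/-- The number
`l_v = l_n ⊖ l_k ⊖ l_{n-k} ⊕ k ⊗ Log p ⊕ (n-k) ⊗ Log(1-p) ⊕ Log(h⁻¹(u)) ⊖ Log α`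
(evaluated from left to right) that BinSamp computes when `k` has been drawn. The computation
`hinv` is the one of `h⁻¹(u)`, with the random number `u` substituted. -/
def logComputedRatio (β t : ℕ) (g : ℝ) (rnd : ℝ → ℝ) (n : ℕ) (p α : ℝ) (hinv : ArithExpr)
    (k : ℕ) : ℝ :=
  let ln := logFactorial β t g n
  let lk := logFactorial β t g k
  let lnk := logFactorial β t g (n - k)
  let s₁ := flSub rnd ln lk
  let s₂ := flSub rnd s₁ lnk
  let s₃ := flAdd rnd s₂ (flMul rnd (k : ℝ) (agmLog β p))
  let s₄ := flAdd rnd s₃ (flMul rnd ((n - k : ℕ) : ℝ) (agmLog β (1 - p)))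
  let s₅ := flAdd rnd s₄ (agmLog β (hinv.flVal rnd))
  flSub rnd s₅ (agmLog β α)

/-- The computed rejection ratio `r̃_k = exp(l_v)`: the test `log v ≤ l_v` accepts `k` when
`v ≤ r̃_k`. -/
def computedRatio (β t : ℕ) (g : ℝ) (rnd : ℝ → ℝ) (n : ℕ) (p α : ℝ) (hinv : ArithExpr)
    (k : ℕ) : ℝ :=
  Real.exp (logComputedRatio β t g rnd n p α hinv k)

end

end BinSamp

/-!
The number `l_v` is a floating-point sum of logarithms, and the ratio `r̃_k / r_k` is the exponential
of its error, so everything reduces to bounding that error. It has four sources.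

* `Log` differs from `log` by at most `8βε`, uniformly in the argument
  (`abs_agmLog_sub_log_le`). Gauss' substitution `t = (ab / x - x) / 2` shows that
  `I(a, b) = ∫₀^∞ dx / √((x² + a²)(x² + b²))` does not change when `(a, b)` is replaced by its two
  means, hence `I(a, b) = π / (2 AGM(a, b))` (`agmIntegral_eq`). The inversion `x ↦ k / x` gives
  `I(1, k) = 2 ∫₀^√k dx / √((x² + 1)(x² + k²))`, and there the Taylor bounds of `1 / √(1 + x²)` lead
  to explicit integrals with `|I(1, k) - log (4 / k)| ≤ k² log (4 / k)`
  (`abs_pi_div_agm_sub_log_le`). For `k = 4 / s` with `s² ≥ 2 / ε` this is `O(βε)`.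
* The computed value of `h⁻¹(u)` has relative error at most `2Cε` with `C = max 1 c`
  (`ArithExpr.abs_flVal_sub_val_le`), by induction over the computation.
* The final additions contribute at most `28ε` times the sum of all magnitudes
  (`abs_chain_sub_le`), and that sum is at most `4(n + 1)β`: the size conditions bound `log n`,
  `|log p|` and `|log (1 - p)|` by multiples of `β`, and domination by the hat gives
  `log h(k) ≥ -nβ - |log α|`.
* The three Lanczos approximations multiply the ratio by a factor `E` with `|E - 1| ≤ 6ζ`
  (`abs_lanczosRatio_div_sub_one_le`).

The first three together give an error `D` of the logarithm with `|D| ≤ (136n + 177)βε`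
(`abs_logComputedRatio_sub_le`). Since `n ≤ ε ^ (-1/2)`, this is at most `1` for large `β`, whatever
`n` is, so `|e^D E - 1| ≤ 6|D| + 6ζ`. The same lower bound for `log h(k)` shows that the nonpositive
term `14 ε log h(k)` of the claim costs at most `14(n + 1)βε`, which the constants leave room for.
-/

namespace BinSamp

open Set MeasureTheory Filter Topology

/-! ### Gauss' integral for the arithmetic-geometric mean -/

/-- The integrand `1 / √((x² + a²)(x² + b²))` of Gauss' integral. -/
noncomputable def agmKernel (a b x : ℝ) : ℝ := 1 / (√(x ^ 2 + a ^ 2) * √(x ^ 2 + b ^ 2))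

/-- Gauss' integral `∫₀^∞ dx / √((x² + a²)(x² + b²))`, as a Lebesgue integral with values in
`[0, ∞]`, so that changes of variables need no integrability. -/
noncomputable def agmIntegral (a b : ℝ) : ENNReal :=
  ∫⁻ x in Ioi 0, ENNReal.ofReal (agmKernel a b x)

lemma agmKernel_nonneg (a b x : ℝ) : 0 ≤ agmKernel a b x := by
  unfold agmKernel; positivity

/-- The density `agmKernel a b x dx` is invariant under the inversion `x ↦ ab / x`. -/
lemma agmKernel_inversion {a b c x : ℝ} (ha : 0 < a) (hb : 0 < b) (hc : c ^ 2 = a * b)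
    (hx : 0 < x) : c ^ 2 / x ^ 2 * agmKernel a b (c ^ 2 / x) = agmKernel a b x := by
  have h1 : √((c ^ 2 / x) ^ 2 + a ^ 2) = a / x * √(x ^ 2 + b ^ 2) := by
    rw [← Real.sqrt_sq (by positivity : 0 ≤ a / x), ← Real.sqrt_mul (by positivity)]
    congr 1
    rw [hc]; field_simp; ring
  have h2 : √((c ^ 2 / x) ^ 2 + b ^ 2) = b / x * √(x ^ 2 + a ^ 2) := by
    rw [← Real.sqrt_sq (by positivity : 0 ≤ b / x), ← Real.sqrt_mul (by positivity)]
    congr 1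
    rw [hc]; field_simp; ring
  have p1 : 0 < √(x ^ 2 + a ^ 2) := by positivity
  have p2 : 0 < √(x ^ 2 + b ^ 2) := by positivity
  unfold agmKernel
  rw [h1, h2, hc]
  field_simp

/-- Gauss' substitution `t = (ab / x - x) / 2` turns the kernel of the two means into twice the
kernel of the original pair. -/
lemma agmKernel_gauss {a b c x : ℝ} (ha : 0 < a) (hb : 0 < b) (hc : c ^ 2 = a * b)
    (hx : 0 < x) :
    (c ^ 2 / x ^ 2 + 1) / 2 * agmKernel ((a + b) / 2) c ((c ^ 2 / x - x) / 2)
      = 2 * agmKernel a b x := by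
  have h1 : √(((c ^ 2 / x - x) / 2) ^ 2 + c ^ 2) = (c ^ 2 / x + x) / 2 := by
    rw [← Real.sqrt_sq (by positivity : 0 ≤ (c ^ 2 / x + x) / 2)]
    congr 1
    field_simp; ring
  have h2 : √(x ^ 2 + a ^ 2) * √(x ^ 2 + b ^ 2)
      = 2 * x * √(((c ^ 2 / x - x) / 2) ^ 2 + ((a + b) / 2) ^ 2) := by
    rw [← Real.sqrt_mul (by positivity), ← Real.sqrt_sq (by positivity : 0 ≤ 2 * x),
      ← Real.sqrt_mul (by positivity)]
    congr 1
    rw [hc]; field_simp; ring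
  have p : 0 < √(((c ^ 2 / x - x) / 2) ^ 2 + ((a + b) / 2) ^ 2) := by positivity
  unfold agmKernel
  rw [h2, h1]
  field_simp

lemma lintegral_agmKernel_Ioi {a b c : ℝ} (ha : 0 < a) (hb : 0 < b) (hc0 : 0 < c)
    (hc : c ^ 2 = a * b) :
    ∫⁻ x in Ioi c, ENNReal.ofReal (agmKernel a b x)
      = ∫⁻ x in Ioo 0 c, ENNReal.ofReal (agmKernel a b x) := by
  have himg : (fun x => c ^ 2 / x) '' Ioo 0 c = Ioi c := by
    ext y
    simp only [mem_image, mem_Ioo, mem_Ioi]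
    constructor
    · rintro ⟨x, ⟨h0, h1⟩, rfl⟩
      rw [lt_div_iff₀ h0]; nlinarith
    · intro hy
      have : 0 < y := hc0.trans hy
      refine ⟨c ^ 2 / y, ⟨by positivity, ?_⟩, by field_simp⟩
      rw [div_lt_iff₀ this]; nlinarith
  rw [← himg, lintegral_image_eq_lintegral_abs_deriv_mul measurableSet_Ioo
    (f' := fun x => -(c ^ 2 / x ^ 2))]
  · refine setLIntegral_congr_fun measurableSet_Ioo fun x hx => ?_
    rw [← ENNReal.ofReal_mul (abs_nonneg _), abs_neg, abs_of_nonneg (by positivity),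
      agmKernel_inversion ha hb hc hx.1]
  · intro x hx
    have := ((hasDerivAt_inv hx.1.ne').const_mul (c ^ 2)).hasDerivWithinAt (s := Ioo 0 c)
    simpa [div_eq_mul_inv] using this
  · intro x hx y hy h
    have := hx.1; have := hy.1
    simp only at h
    field_simp at h
    exact h.symm

lemma agmIntegral_eq_two_mul {a b c : ℝ} (ha : 0 < a) (hb : 0 < b) (hc0 : 0 < c)
    (hc : c ^ 2 = a * b) :
    agmIntegral a b = 2 * ∫⁻ x in Ioo 0 c, ENNReal.ofReal (agmKernel a b x) := by
  have : Ioi (0 : ℝ) = Ioc 0 c ∪ Ioi c := (Ioc_union_Ioi_eq_Ioi hc0.le).symm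
  rw [agmIntegral, this, lintegral_union measurableSet_Ioi, lintegral_agmKernel_Ioi ha hb hc0 hc,
    two_mul, setLIntegral_congr Ioo_ae_eq_Ioc]
  rw [Set.disjoint_left]
  intro x hx hx'
  exact absurd hx.2 (not_le.2 hx')

lemma agmIntegral_means_eq_two_mul {a b c : ℝ} (ha : 0 < a) (hb : 0 < b) (hc0 : 0 < c)
    (hc : c ^ 2 = a * b) :
    agmIntegral ((a + b) / 2) c = 2 * ∫⁻ x in Ioo 0 c, ENNReal.ofReal (agmKernel a b x) := by
  have himg : (fun x => (c ^ 2 / x - x) / 2) '' Ioo 0 c = Ioi 0 := by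
    ext y
    simp only [mem_image, mem_Ioo, mem_Ioi]
    constructor
    · rintro ⟨x, ⟨h0, h1⟩, rfl⟩
      have : x < c ^ 2 / x := by rw [lt_div_iff₀ h0]; nlinarith
      linarith
    · intro hy
      have hs : √(y ^ 2 + c ^ 2) ^ 2 = y ^ 2 + c ^ 2 := Real.sq_sqrt (by positivity)
      have hs1 : y < √(y ^ 2 + c ^ 2) := Real.lt_sqrt_of_sq_lt (by nlinarith)
      have hs2 : √(y ^ 2 + c ^ 2) < y + c := by
        rw [Real.sqrt_lt' (by positivity)]; nlinarith [mul_pos hy hc0]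
      refine ⟨√(y ^ 2 + c ^ 2) - y, ⟨by linarith, by linarith⟩, ?_⟩
      have : √(y ^ 2 + c ^ 2) - y ≠ 0 := by linarith
      field_simp
      nlinarith
  rw [agmIntegral, ← himg, lintegral_image_eq_lintegral_abs_deriv_mul measurableSet_Ioo
    (f' := fun x => (-(c ^ 2 / x ^ 2) - 1) / 2),
    ← lintegral_const_mul' _ _ (by simp)]
  · refine setLIntegral_congr_fun measurableSet_Ioo fun x hx => ?_
    have h0 := hx.1
    have : |(-(c ^ 2 / x ^ 2) - 1) / 2| = (c ^ 2 / x ^ 2 + 1) / 2 := by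
      rw [abs_of_nonpos]
      · ring
      · have : 0 ≤ c ^ 2 / x ^ 2 := by positivity
        linarith
    rw [← ENNReal.ofReal_mul (abs_nonneg _), this, agmKernel_gauss ha hb hc h0,
      ENNReal.ofReal_mul (by norm_num)]
    simp
  · intro x hx
    have := ((((hasDerivAt_inv hx.1.ne').const_mul (c ^ 2)).sub (hasDerivAt_id x)).div_const
      2).hasDerivWithinAt (s := Ioo 0 c)
    simpa [div_eq_mul_inv] using this
  · have hanti : StrictAntiOn (fun x => (c ^ 2 / x - x) / 2) (Ioo 0 c) := by
      intro x hx y hy h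
      have : c ^ 2 / y < c ^ 2 / x := div_lt_div_of_pos_left (by positivity) hx.1 h
      simp only
      linarith
    exact hanti.injOn

/-- Gauss' integral is unchanged when a pair is replaced by its two means. -/
lemma agmIntegral_means {a b : ℝ} (ha : 0 < a) (hb : 0 < b) :
    agmIntegral ((a + b) / 2) (√(a * b)) = agmIntegral a b := by
  have hc : √(a * b) ^ 2 = a * b := Real.sq_sqrt (by positivity)
  have hc0 : 0 < √(a * b) := by positivity
  rw [agmIntegral_eq_two_mul ha hb hc0 hc, agmIntegral_means_eq_two_mul ha hb hc0 hc]

lemma agmIntegral_comm (a b : ℝ) : agmIntegral a b = agmIntegral b a := by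
  simp only [agmIntegral, agmKernel, mul_comm]

lemma agmIntegral_self {a : ℝ} (ha : 0 < a) :
    agmIntegral a a = ENNReal.ofReal (Real.pi / (2 * a)) := by
  have hd : ∀ x : ℝ, HasDerivAt (fun x => Real.arctan (x / a) / a) (agmKernel a a x) x := by
    intro x
    have := (((hasDerivAt_id x).div_const a).arctan).div_const a
    refine this.congr_deriv ?_
    simp only [agmKernel, id]
    rw [Real.mul_self_sqrt (by positivity)]
    field_simp
    ring
  have ht : Tendsto (fun x => Real.arctan (x / a) / a) atTop (𝓝 (Real.pi / 2 / a)) :=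
    ((Real.tendsto_arctan_atTop.mono_right nhdsWithin_le_nhds).comp
      (tendsto_id.atTop_div_const ha)).div_const a
  have hcont : ContinuousWithinAt (fun x => Real.arctan (x / a) / a) (Ici 0) 0 :=
    (hd 0).continuousAt.continuousWithinAt
  rw [agmIntegral, ← ofReal_integral_eq_lintegral_ofReal
    (integrableOn_Ioi_deriv_of_nonneg hcont (fun x _ => hd x)
      (fun x _ => agmKernel_nonneg a a x) ht)
    (Eventually.of_forall fun x => agmKernel_nonneg a a x),
    integral_Ioi_of_hasDerivAt_of_nonneg hcont (fun x _ => hd x)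
      (fun x _ => agmKernel_nonneg a a x) ht]
  simp [div_div]

lemma agmIntegral_anti {a b a' b' : ℝ} (ha : 0 < a) (hb : 0 < b) (haa : a ≤ a') (hbb : b ≤ b') :
    agmIntegral a' b' ≤ agmIntegral a b := by
  refine lintegral_mono fun x => ENNReal.ofReal_le_ofReal ?_
  unfold agmKernel
  have p1 : 0 < √(x ^ 2 + a ^ 2) := by positivity
  have p2 : 0 < √(x ^ 2 + b ^ 2) := by positivity
  gcongr

lemma agmIntegral_agmSequences {a b : NNReal} (ha : 0 < a) (hb : 0 < b) (n : ℕ) :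
    agmIntegral (NNReal.agmSequences a b n).1 (NNReal.agmSequences a b n).2
      = agmIntegral a b := by
  induction n generalizing a b with
  | zero =>
    rw [NNReal.agmSequences_zero, agmIntegral_comm, ← agmIntegral_means (a := a) (b := b)
      (by exact_mod_cast ha) (by exact_mod_cast hb)]
    push_cast
    rfl
  | succ n ih =>
    rw [NNReal.agmSequences_succ, ih (by positivity) (by positivity), agmIntegral_comm,
      ← agmIntegral_means (a := a) (b := b) (by exact_mod_cast ha) (by exact_mod_cast hb)]
    push_cast
    rfl

/-- Gauss' theorem. The invariance of the integral reduces it to pairs of nearly equal numbers,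
where it is squeezed between its values at equal pairs. -/
theorem agmIntegral_eq {a b : NNReal} (ha : 0 < a) (hb : 0 < b) :
    agmIntegral a b = ENNReal.ofReal (Real.pi / (2 * NNReal.agm a b)) := by
  have hpos := NNReal.agm_pos ha hb
  have key : Tendsto (fun x : NNReal => ENNReal.ofReal (Real.pi / (2 * (x : ℝ))))
      (𝓝 (NNReal.agm a b)) (𝓝 (ENNReal.ofReal (Real.pi / (2 * NNReal.agm a b)))) := by
    refine ENNReal.tendsto_ofReal (Tendsto.div tendsto_const_nhds ?_ ?_)
    · exact (NNReal.continuous_coe.tendsto _).const_mul 2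
    · have : (0 : ℝ) < NNReal.agm a b := by exact_mod_cast hpos
      positivity
  have hseq : ∀ n, 0 < (NNReal.agmSequences a b n).1 := fun n =>
    lt_of_lt_of_le (by simp only [NNReal.agmSequences_zero]; positivity)
      (NNReal.agmSequences_fst_monotone (Nat.zero_le n))
  have hle : ∀ n, ((NNReal.agmSequences a b n).1 : ℝ) ≤ (NNReal.agmSequences a b n).2 := fun n =>
    by exact_mod_cast NNReal.agmSequences_fst_le_snd n n
  have hseq' : ∀ n, (0 : ℝ) < (NNReal.agmSequences a b n).1 := fun n => by exact_mod_cast hseq n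
  refine le_antisymm
    (ge_of_tendsto' (key.comp NNReal.tendsto_agmSequences_fst_agm) fun n => ?_)
    (le_of_tendsto' (key.comp NNReal.tendsto_agmSequences_snd_agm) fun n => ?_)
  · rw [← agmIntegral_agmSequences ha hb n, Function.comp, ← agmIntegral_self (hseq' n)]
    exact agmIntegral_anti (hseq' n) (hseq' n) le_rfl (hle n)
  · rw [← agmIntegral_agmSequences ha hb n, Function.comp,
      ← agmIntegral_self ((hseq' n).trans_le (hle n))]
    exact agmIntegral_anti (hseq' n) ((hseq' n).trans_le (hle n)) (hle n) le_rfl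

/-! ### The logarithm by the arithmetic-geometric mean -/

lemma one_sub_le_inv_sqrt {x : ℝ} (h : x ^ 2 ≤ 1) : 1 - x ^ 2 / 2 ≤ 1 / √(x ^ 2 + 1) := by
  have hp : 0 < √(x ^ 2 + 1) := by positivity
  rw [le_div_iff₀ hp, ← Real.sqrt_sq (by linarith : 0 ≤ 1 - x ^ 2 / 2),
    ← Real.sqrt_mul (by positivity), Real.sqrt_le_one]
  nlinarith [sq_nonneg x, mul_nonneg (sq_nonneg (x ^ 2)) (sub_nonneg.2 h)]

lemma inv_sqrt_le {x : ℝ} (h : x ^ 2 ≤ 1) :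
    1 / √(x ^ 2 + 1) ≤ 1 - x ^ 2 / 2 + 3 / 8 * x ^ 4 := by
  have hp : 0 < √(x ^ 2 + 1) := by positivity
  have h0 : 0 ≤ 1 - x ^ 2 / 2 + 3 / 8 * x ^ 4 := by nlinarith [sq_nonneg (x ^ 2)]
  rw [div_le_iff₀ hp, ← Real.sqrt_sq h0, ← Real.sqrt_mul (by positivity), Real.one_le_sqrt]
  have h1 : 0 ≤ (x ^ 2) ^ 3 * (1 - x ^ 2) := mul_nonneg (by positivity) (by linarith)
  have h2 : 0 ≤ (x ^ 2) ^ 5 := by positivity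
  have h3 : 0 ≤ (x ^ 2) ^ 3 := by positivity
  nlinarith

/-- An antiderivative of `(1 - x² / 2) / √(x² + k²)`. -/
lemma hasDerivAt_agmPrimitive {k : ℝ} (hk : 0 < k) (x : ℝ) :
    HasDerivAt (fun x => Real.arsinh (x / k)
      - 1 / 4 * (x * √(x ^ 2 + k ^ 2) - k ^ 2 * Real.arsinh (x / k)))
      ((1 - x ^ 2 / 2) * (1 / √(x ^ 2 + k ^ 2))) x := by
  have hw : 0 < √(x ^ 2 + k ^ 2) := by positivity
  have hs : √(x ^ 2 + k ^ 2) ^ 2 = x ^ 2 + k ^ 2 := Real.sq_sqrt (by positivity)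
  have h1 : HasDerivAt (fun x => Real.arsinh (x / k)) (1 / √(x ^ 2 + k ^ 2)) x := by
    refine ((hasDerivAt_id x).div_const k).arsinh.congr_deriv ?_
    have : √(1 + (id x / k) ^ 2) = √(x ^ 2 + k ^ 2) / k := by
      rw [eq_div_iff hk.ne']
      nth_rewrite 2 [← Real.sqrt_sq hk.le]
      rw [← Real.sqrt_mul (by positivity)]
      congr 1
      simp only [id]; field_simp; ring
    rw [this]
    simp only [smul_eq_mul]
    field_simp
  have h2 : HasDerivAt (fun x : ℝ => √(x ^ 2 + k ^ 2)) (x / √(x ^ 2 + k ^ 2)) x := by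
    refine (((hasDerivAt_pow 2 x).add_const (k ^ 2)).sqrt (by positivity)).congr_deriv ?_
    simp only [Nat.cast_ofNat, Nat.add_one_sub_one, pow_one]
    field_simp
  refine (h1.sub ((((hasDerivAt_id x).mul h2).sub (h1.const_mul (k ^ 2))).const_mul
    (1 / 4))).congr_deriv ?_
  simp only [id]
  field_simp
  rw [hs]
  ring

lemma agmKernel_continuous {k : ℝ} (hk : 0 < k) : Continuous (agmKernel 1 k) := by
  unfold agmKernel
  refine continuous_const.div (by fun_prop) fun x => ?_
  positivity

/-- Two-sided bounds for half of Gauss' integral of the pair `(1, k)`, with `A = arsinh (1 / √k)`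
and `q = √(1 + k)`. -/
lemma integral_agmKernel_bounds {k : ℝ} (hk : 0 < k) (hk1 : k ≤ 1) :
    Real.arsinh (1 / √k) - 1 / 4 * (k * √(1 + k) - k ^ 2 * Real.arsinh (1 / √k))
        ≤ ∫ x in (0 : ℝ)..√k, agmKernel 1 k x ∧
      ∫ x in (0 : ℝ)..√k, agmKernel 1 k x
        ≤ Real.arsinh (1 / √k) - 1 / 4 * (k * √(1 + k) - k ^ 2 * Real.arsinh (1 / √k))
          + 3 / 32 * k ^ 2 := by
  have hr : 0 < √k := by positivity
  have hr2 : √k ^ 2 = k := Real.sq_sqrt hk.le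
  have hx1 : ∀ x ∈ Icc 0 √k, x ^ 2 ≤ 1 := fun x hx => by nlinarith [hx.1, hx.2]
  have e1 : √k / k = 1 / √k := by
    rw [div_eq_div_iff hk.ne' hr.ne', one_mul, ← sq, hr2]
  have e2 : √k * √(√k ^ 2 + k ^ 2) = k * √(1 + k) := by
    rw [hr2, show k + k ^ 2 = k * (1 + k) by ring, Real.sqrt_mul hk.le, ← mul_assoc, ← sq, hr2]
  have e4 : √k ^ 4 = k ^ 2 := by
    rw [show √k ^ 4 = (√k ^ 2) ^ 2 by ring, hr2]
  have hc0 : Continuous fun x : ℝ => (1 - x ^ 2 / 2) * (1 / √(x ^ 2 + k ^ 2)) :=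
    (by fun_prop : Continuous fun x : ℝ => 1 - x ^ 2 / 2).mul
      (continuous_const.div (by fun_prop) fun x => by positivity)
  have hc1 : Continuous fun x : ℝ => 3 / 8 * x ^ 3 := by fun_prop
  have I0 := intervalIntegral.integral_eq_sub_of_hasDerivAt
    (fun x _ => hasDerivAt_agmPrimitive hk x) (hc0.intervalIntegrable 0 √k)
  simp only [zero_div, Real.arsinh_zero, zero_mul, mul_zero, sub_zero, e1, e2] at I0
  have I1 : ∫ x in (0 : ℝ)..√k, 3 / 8 * x ^ 3 = 3 / 32 * k ^ 2 := by
    rw [intervalIntegral.integral_const_mul, integral_pow]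
    norm_num [e4]; ring
  have split : ∀ x, agmKernel 1 k x = 1 / √(x ^ 2 + 1) * (1 / √(x ^ 2 + k ^ 2)) := fun x => by
    rw [agmKernel, one_pow, one_div_mul_one_div]
  constructor
  · rw [← I0]
    refine intervalIntegral.integral_mono_on hr.le (hc0.intervalIntegrable _ _)
      ((agmKernel_continuous hk).intervalIntegrable _ _) fun x hx => ?_
    rw [split]
    have := one_sub_le_inv_sqrt (hx1 x hx)
    gcongr
  · rw [← I0, ← I1, ← intervalIntegral.integral_add (hc0.intervalIntegrable _ _)
      (hc1.intervalIntegrable _ _)]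
    refine intervalIntegral.integral_mono_on hr.le
      ((agmKernel_continuous hk).intervalIntegrable _ _)
      ((hc0.add hc1).intervalIntegrable _ _) fun x hx => ?_
    have hw : 0 < √(x ^ 2 + k ^ 2) := by positivity
    have hxw : x ≤ √(x ^ 2 + k ^ 2) := Real.le_sqrt_of_sq_le (by nlinarith)
    have h4 : x ^ 4 * (1 / √(x ^ 2 + k ^ 2)) ≤ x ^ 3 := by
      rw [mul_one_div, div_le_iff₀ hw]
      have := mul_le_mul_of_nonneg_left hxw (pow_nonneg hx.1 3)
      calc x ^ 4 = x ^ 3 * x := by ring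
        _ ≤ _ := this
    rw [split]
    have := mul_le_mul_of_nonneg_right (inv_sqrt_le (hx1 x hx))
      (by positivity : 0 ≤ 1 / √(x ^ 2 + k ^ 2))
    linarith

lemma pi_div_agm_eq {k : ℝ} (hk : 0 < k) :
    Real.pi / (2 * (NNReal.agm 1 (Real.toNNReal k) : ℝ))
      = 2 * ∫ x in (0 : ℝ)..√k, agmKernel 1 k x := by
  have hr : 0 < √k := by positivity
  have hkn : 0 < Real.toNNReal k := Real.toNNReal_pos.2 hk
  have h := agmIntegral_eq (a := 1) one_pos hkn
  rw [Real.coe_toNNReal k hk.le, NNReal.coe_one, agmIntegral_eq_two_mul one_pos hk hr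
    (by rw [Real.sq_sqrt hk.le, one_mul]), setLIntegral_congr Ioo_ae_eq_Ioc,
    ← ofReal_integral_eq_lintegral_ofReal, ← intervalIntegral.integral_of_le hr.le,
    ← ENNReal.ofReal_ofNat 2, ← ENNReal.ofReal_mul (by norm_num), ENNReal.ofReal_eq_ofReal_iff]
    at h
  · exact h.symm
  · exact mul_nonneg (by norm_num)
      (intervalIntegral.integral_nonneg hr.le fun x _ => agmKernel_nonneg _ _ _)
  · positivity
  · exact (intervalIntegrable_iff_integrableOn_Ioc_of_le hr.le).1
      ((agmKernel_continuous hk).intervalIntegrable _ _)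
  · exact Eventually.of_forall fun x => agmKernel_nonneg _ _ _

/-- The first-order terms `k / 2` in the expansions of `2 arsinh (1 / √k)` and of the correction
cancel, which leaves an error of second order in `k`. -/
theorem abs_pi_div_agm_sub_log_le {k : ℝ} (hk : 0 < k) (hk1 : k ≤ 1) :
    |Real.pi / (2 * (NNReal.agm 1 (Real.toNNReal k) : ℝ)) - Real.log (4 / k)|
      ≤ k ^ 2 * Real.log (4 / k) := by
  obtain ⟨hlo, hhi⟩ := integral_agmKernel_bounds hk hk1
  rw [pi_div_agm_eq hk]
  set J := ∫ x in (0 : ℝ)..√k, agmKernel 1 k x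
  set A := Real.arsinh (1 / √k) with hA
  set q := √(1 + k) with hq
  have hr : 0 < √k := by positivity
  have hr2 : √k ^ 2 = k := Real.sq_sqrt hk.le
  have hq2 : q ^ 2 = 1 + k := Real.sq_sqrt (by positivity)
  have hq1 : 1 ≤ q := Real.one_le_sqrt.2 (by linarith)
  set y := (q - 1) / 2 with hy
  have hy0 : 0 ≤ y := by linarith
  have hqy : q = 1 + 2 * y := by rw [hy]; ring
  have hky : k = 4 * y + 4 * y ^ 2 := by
    have := hq2
    rw [hqy] at this
    nlinarith
  have hyk : y ≤ k / 4 := by nlinarith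
  have h2A : 2 * A = Real.log (4 / k) + 2 * Real.log (1 + y) := by
    have hs : √(1 + (1 / √k) ^ 2) = q / √k := by
      rw [div_pow, hr2, hq, ← Real.sqrt_div (by positivity)]
      congr 1
      field_simp; ring
    have : A = Real.log ((1 + q) / √k) := by
      rw [hA, Real.arsinh, hs, add_div]
    have e : (2 : ℝ) * Real.log ((1 + q) / √k) = Real.log (((1 + q) / √k) ^ 2) := by
      rw [Real.log_pow]; norm_num
    have e' : (2 : ℝ) * Real.log (1 + y) = Real.log ((1 + y) ^ 2) := by
      rw [Real.log_pow]; norm_num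
    rw [this, e, e', ← Real.log_mul (by positivity) (by positivity), div_pow, hr2]
    congr 1
    rw [hqy]; field_simp; ring
  have hl : 1 ≤ Real.log (4 / k) := by
    rw [Real.le_log_iff_exp_le (by positivity), le_div_iff₀ hk]
    nlinarith [Real.exp_one_lt_d9, Real.exp_pos 1]
  have hl1 : Real.log (1 + y) ≤ y := by
    have := Real.log_le_sub_one_of_pos (by positivity : 0 < 1 + y)
    linarith
  have hl2 : y - y ^ 2 ≤ Real.log (1 + y) := by
    refine le_trans ?_ (Real.one_sub_inv_le_log_of_pos (by positivity : 0 < 1 + y))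
    have : (1 + y)⁻¹ ≤ 1 - y + y ^ 2 := by
      rw [inv_le_iff_one_le_mul₀ (by positivity)]
      nlinarith [pow_nonneg hy0 3]
    linarith
  have hkq : k * q / 2 = 2 * y + 6 * y ^ 2 + 4 * y ^ 3 := by rw [hky, hqy]; ring
  have hk0 : 0 ≤ k ^ 2 := by positivity
  have hyk2 : y ^ 2 ≤ k ^ 2 / 16 := by nlinarith
  have hyk3 : y ^ 3 ≤ k ^ 2 / 64 := by
    have : y ^ 3 = y ^ 2 * y := by ring
    nlinarith
  have hA0 : 0 ≤ k ^ 2 * A := mul_nonneg hk0 (Real.arsinh_nonneg_iff.2 (by positivity))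
  have hA1 : k ^ 2 * A ≤ k ^ 2 * (Real.log (4 / k) / 2 + 1 / 4) := by
    refine mul_le_mul_of_nonneg_left ?_ hk0
    linarith
  have hkl : k ^ 2 * 1 ≤ k ^ 2 * Real.log (4 / k) := mul_le_mul_of_nonneg_left hl hk0
  have hy3 : 0 ≤ y ^ 3 := by positivity
  rw [abs_le]
  constructor <;> nlinarith

/-- `Log` approximates the logarithm with an absolute error that is independent of the argument,
because the scaled argument `s = x · 2 ^ m` satisfies `2 ^ (β + 1) ≤ s²`. -/
theorem abs_agmLog_sub_log_le {β : ℕ} (hβ : 5 ≤ β) {x : ℝ} (hx : 0 < x) :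
    |agmLog β x - Real.log x| ≤ 8 * β * unitRoundoff β := by
  set M : ℤ := ⌈((β : ℝ) + 3) / 2⌉ with hM
  set s : ℝ := x * 2 ^ logShift β x with hs
  have hs0 : 0 < s := by positivity
  have h2 : (2 : ℝ) ≠ 0 := by norm_num
  have hMβ : ((β : ℝ) + 3) / 2 ≤ M := Int.le_ceil _
  have hMβ' : (M : ℝ) < ((β : ℝ) + 3) / 2 + 1 := Int.ceil_lt_add_one _
  have hβ' : (5 : ℝ) ≤ β := by exact_mod_cast hβ
  have hlo : (2 : ℝ) ^ (M - 1) ≤ s := by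
    have := Int.zpow_log_le_self (b := 2) (by norm_num) hx
    have e : (2 : ℝ) ^ (M - 1) = 2 ^ Int.log 2 x * 2 ^ logShift β x := by
      rw [← zpow_add₀ h2]; congr 1; simp only [logShift, exponent, ← hM]; ring
    rw [e, hs]
    push_cast at this
    gcongr
  have hhi : s ≤ (2 : ℝ) ^ M := by
    have := Int.lt_zpow_succ_log_self (b := 2) (by norm_num) x
    have e : (2 : ℝ) ^ M = 2 ^ (Int.log 2 x + 1) * 2 ^ logShift β x := by
      rw [← zpow_add₀ h2]; congr 1; simp only [logShift, exponent, ← hM]; ring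
    rw [e, hs]
    push_cast at this
    gcongr
  have hM1 : (β : ℤ) + 1 ≤ 2 * (M - 1) := by
    have : ((β : ℤ) : ℝ) + 1 ≤ ((2 * (M - 1) : ℤ) : ℝ) := by push_cast; linarith
    exact_mod_cast this
  have hMle : (M : ℝ) ≤ β := by
    have : 2 * M < (β : ℤ) + 5 := by
      have : ((2 * M : ℤ) : ℝ) < (((β : ℤ) + 5 : ℤ) : ℝ) := by push_cast; linarith
      exact_mod_cast this
    have : M ≤ (β : ℤ) := by omega
    exact_mod_cast this
  have hs2 : (2 : ℝ) * 2 ^ β ≤ s ^ 2 := by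
    calc (2 : ℝ) * 2 ^ β = 2 ^ ((β : ℤ) + 1) := by
          rw [zpow_add₀ h2, zpow_natCast, zpow_one, mul_comm]
      _ ≤ 2 ^ (2 * (M - 1)) := zpow_le_zpow_right₀ (by norm_num) hM1
      _ = (2 ^ (M - 1)) ^ 2 := by rw [mul_comm, zpow_mul]; norm_cast
      _ ≤ s ^ 2 := by gcongr
  have hp : (2 : ℝ) ^ 5 ≤ 2 ^ β := pow_le_pow_right₀ (by norm_num) hβ
  have hs4 : 4 ≤ s := by nlinarith
  have hlogs : Real.log s ≤ β := by
    have h1 : Real.log s ≤ M * Real.log 2 := by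
      rw [← Real.log_zpow]; exact Real.log_le_log hs0 hhi
    have h3 := Real.log_two_lt_d9
    have h4 := Real.log_two_gt_d9
    nlinarith
  have hlog0 : 0 ≤ Real.log s := Real.log_nonneg (by linarith)
  have hmain := abs_pi_div_agm_sub_log_le (k := 4 / s) (by positivity)
    ((div_le_one hs0).2 hs4)
  have e4 : 4 / (4 / s) = s := by field_simp
  rw [e4] at hmain
  have hlx : Real.log s = Real.log x + logShift β x * Real.log 2 := by
    rw [hs, Real.log_mul hx.ne' (by positivity), Real.log_zpow]
  have hrw : agmLog β x - Real.log x
      = Real.pi / (2 * (NNReal.agm 1 (Real.toNNReal (4 / s)) : ℝ)) - Real.log s := by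
    rw [hlx, agmLog]; ring
  rw [hrw]
  refine hmain.trans ?_
  have hk2 : (4 / s) ^ 2 ≤ 8 * unitRoundoff β := by
    rw [unitRoundoff, div_pow, div_le_iff₀ (by positivity)]
    have : (0 : ℝ) < 2 ^ β := by positivity
    field_simp
    nlinarith
  have hu : 0 ≤ unitRoundoff β := by unfold unitRoundoff; positivity
  calc (4 / s) ^ 2 * Real.log s ≤ 8 * unitRoundoff β * β :=
        mul_le_mul hk2 hlogs hlog0 (by positivity)
    _ = _ := by ring

/-! ### Rounding and the computed inverse hat function -/

lemma unitRoundoff_pos (β : ℕ) : 0 < unitRoundoff β := by unfold unitRoundoff; positivity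

lemma neg_mem_floats {β : ℕ} {x : ℝ} (h : x ∈ floats β) : -x ∈ floats β := by
  rcases h with rfl | ⟨w, e, h1, h2, ⟨m, hm⟩, rfl⟩
  · exact Or.inl neg_zero
  · exact Or.inr ⟨-w, e, by rwa [abs_neg], by rwa [abs_neg], ⟨-m, by push_cast; linarith⟩, by ring⟩

lemma exists_mem_floats_near_of_pos {β : ℕ} (hβ : 1 ≤ β) {x : ℝ} (hx : 0 < x) :
    ∃ y ∈ floats β, |y - x| ≤ unitRoundoff β * x := by
  set e : ℤ := Int.log 2 x + 1 with he
  have hE : (0 : ℝ) < 2 ^ e := by positivity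
  have hB : (0 : ℝ) < 2 ^ β := by positivity
  obtain ⟨b, rfl⟩ : ∃ b, β = b + 1 := ⟨β - 1, by omega⟩
  have hlo : (2 : ℝ) ^ e / 2 ≤ x := by
    have := Int.zpow_log_le_self (b := 2) (by norm_num) hx
    rw [he, zpow_add₀ (by norm_num), zpow_one]
    push_cast at this
    linarith
  have hhi : x < (2 : ℝ) ^ e := by
    have := Int.lt_zpow_succ_log_self (b := 2) (by norm_num) x
    push_cast at this
    exact this
  set v : ℝ := x / 2 ^ e with hv
  have hxv : x = v * 2 ^ e := by rw [hv]; field_simp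
  have hv1 : 1 / 2 ≤ v := by rw [hv, le_div_iff₀ hE]; linarith
  have hv2 : v ≤ 1 := by rw [hv, div_le_iff₀ hE]; linarith
  set r : ℤ := round (v * 2 ^ (b + 1)) with hr
  have hrr : |v * 2 ^ (b + 1) - r| ≤ 1 / 2 := abs_sub_round _
  have hr1 : (2 : ℝ) ^ b ≤ r := by
    have h1 : (2 : ℝ) ^ b ≤ v * 2 ^ (b + 1) := by
      rw [pow_succ]; nlinarith [pow_pos two_pos b (M₀ := ℝ)]
    have h2 : ((2 ^ b : ℤ) : ℝ) < ((r + 1 : ℤ) : ℝ) := by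
      push_cast; linarith [(abs_le.1 hrr).2]
    have h3 : (2 ^ b : ℤ) ≤ r := by have := Int.cast_lt.1 h2; omega
    exact_mod_cast h3
  have hr2 : (r : ℝ) ≤ 2 ^ (b + 1) := by
    have h1 : v * 2 ^ (b + 1) ≤ 2 ^ (b + 1) := by nlinarith
    have h2 : (r : ℝ) < ((2 ^ (b + 1) + 1 : ℤ) : ℝ) := by
      push_cast; linarith [(abs_le.1 hrr).1]
    have h3 : r ≤ 2 ^ (b + 1) := by have := Int.cast_lt.1 h2; omega
    exact_mod_cast h3
  have hr0 : (0 : ℝ) < r := lt_of_lt_of_le (by positivity) hr1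
  refine ⟨r / 2 ^ (b + 1) * 2 ^ e, Or.inr ⟨r / 2 ^ (b + 1), e, ?_, ?_, ⟨r, by field_simp⟩, rfl⟩, ?_⟩
  · rw [abs_of_pos (by positivity), le_div_iff₀ hB, pow_succ]; linarith
  · rw [abs_of_pos (by positivity), div_le_one hB]; exact hr2
  · have h1 : r / 2 ^ (b + 1) * 2 ^ e - x = (r - v * 2 ^ (b + 1)) * (2 ^ e / 2 ^ (b + 1)) := by
      rw [hxv]; field_simp
    rw [h1, abs_mul, abs_sub_comm, abs_of_pos (by positivity : (0 : ℝ) < 2 ^ e / 2 ^ (b + 1)),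
      unitRoundoff]
    calc |v * 2 ^ (b + 1) - r| * (2 ^ e / 2 ^ (b + 1)) ≤ 1 / 2 * (2 ^ e / 2 ^ (b + 1)) := by gcongr
      _ = 1 / 2 ^ (b + 1) * (2 ^ e / 2) := by ring
      _ ≤ _ := by gcongr

/-- Rounding to nearest has relative error at most `ε`. -/
lemma IsRoundToNearest.abs_sub_le {β : ℕ} {rnd : ℝ → ℝ} (h : IsRoundToNearest β rnd)
    (hβ : 1 ≤ β) (x : ℝ) : |rnd x - x| ≤ unitRoundoff β * |x| := by
  rcases lt_trichotomy x 0 with hx | rfl | hx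
  · obtain ⟨y, hy, hyx⟩ := exists_mem_floats_near_of_pos hβ (neg_pos.2 hx)
    refine ((h x).2 (-y) (neg_mem_floats hy)).trans ?_
    rw [abs_of_neg hx, show -y - x = -(y - -x) by ring, abs_neg]
    exact hyx
  · simpa using (h 0).2 0 (Or.inl rfl)
  · obtain ⟨y, hy, hyx⟩ := exists_mem_floats_near_of_pos hβ hx
    rw [abs_of_pos hx]
    exact ((h x).2 y hy).trans hyx

lemma IsRoundToNearest.eq_of_mem {β : ℕ} {rnd : ℝ → ℝ} (h : IsRoundToNearest β rnd) {x : ℝ}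
    (hx : x ∈ floats β) : rnd x = x := by
  have := (h x).2 x hx
  rw [sub_self, abs_zero] at this
  exact sub_eq_zero.1 (abs_eq_zero.1 (le_antisymm this (abs_nonneg _)))

/-- One more rounding raises a relative error `2εκ + ε / 2` to at most `2ε(κ + 1)`. -/
lemma abs_round_sub_le {rnd : ℝ → ℝ} {ε C κ z v : ℝ} (hr : ∀ x, |rnd x - x| ≤ ε * |x|)
    (hε : 0 < ε) (hC : 1 ≤ C) (hCε : 32 * C ^ 2 * ε ≤ 1) (hκC : κ ≤ C)
    (hz : |z - v| ≤ (2 * ε * κ + ε / 2) * |v|) : |rnd z - v| ≤ 2 * ε * (κ + 1) * |v| := by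
  have hv := abs_nonneg v
  have h1 : |z| ≤ |v| + (2 * ε * κ + ε / 2) * |v| := by
    have := abs_sub_abs_le_abs_sub z v
    linarith
  have h2 : |rnd z - v| ≤ |rnd z - z| + |z - v| := abs_sub_le _ _ _
  have h3 : ε * |z| ≤ ε * (|v| + (2 * ε * κ + ε / 2) * |v|) := by gcongr
  have hCε' : 32 * C * ε ≤ 1 := by nlinarith [mul_pos (by linarith : 0 < C) hε]
  have hκε : 2 * ε * κ ≤ 1 / 16 := by nlinarith
  have h4 : ε * (2 * ε * κ + ε / 2) * |v| ≤ ε * (1 / 2) * |v| := by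
    gcongr
    nlinarith
  have := hr z
  nlinarith

/-- The amplification is a valid error bound up to a factor `2`. The bound is linear in the
amplification, so it survives sums, whose amplification need not exceed that of the operands; the
factor `2` leaves room for all terms of higher order, however long the computation is. -/
theorem ArithExpr.abs_flVal_sub_val_le {β : ℕ} {c C : ℝ} {rnd : ℝ → ℝ}
    (hrnd : IsRoundToNearest β rnd) (hβ : 1 ≤ β) (hC : 1 ≤ C) (hcC : c ≤ C)
    (hCε : 32 * C ^ 2 * unitRoundoff β ≤ 1) (x : ArithExpr) (hx : x.Admissible β c) :
    x.flVal rnd ∈ floats β ∧ 0 ≤ x.amp β ∧ x.amp β ≤ C ∧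
      |x.flVal rnd - x.val| ≤ 2 * unitRoundoff β * x.amp β * |x.val| := by
  have hε := unitRoundoff_pos β
  have hr := fun x => hrnd.abs_sub_le hβ x
  set ε := unitRoundoff β
  have hCε' : 32 * C * ε ≤ 1 := by nlinarith [mul_pos (by linarith : 0 < C) hε]
  -- products of two relative errors are at most `ε / 8`
  have hprod : ∀ {κ κ' : ℝ}, 0 ≤ κ → κ ≤ C → 0 ≤ κ' → κ' ≤ C →
      (2 * ε * κ) * (2 * ε * κ') ≤ ε / 8 := by
    intro κ κ' h1 h2 h3 h4
    have : κ * κ' ≤ C * C := by gcongr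
    have := mul_le_mul_of_nonneg_left this (by positivity : 0 ≤ ε * ε)
    nlinarith
  -- operands of a sum or a difference
  have hsum : ∀ {κ κ' a b u v w : ℝ}, 0 ≤ κ → 0 ≤ κ' → |a - u| ≤ 2 * ε * κ * |u| →
      |b - v| ≤ 2 * ε * κ' * |v| → w ≠ 0 →
      2 * ε * κ * |u| + 2 * ε * κ' * |v|
        ≤ (2 * ε * ((|u| * κ + |v| * κ') / |w|) + ε / 2) * |w| := by
    intro κ κ' a b u v w h1 h2 h3 h4 hw
    have hw' : 0 < |w| := abs_pos.2 hw
    have : (2 * ε * ((|u| * κ + |v| * κ') / |w|) + ε / 2) * |w|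
        = 2 * ε * (|u| * κ + |v| * κ') + ε / 2 * |w| := by field_simp
    rw [this]
    nlinarith [mul_pos hε hw']
  induction x with
  | input r =>
    refine ⟨(hrnd r).1, ?_⟩
    simp only [flVal, val, amp]
    split_ifs with h
    · rw [hrnd.eq_of_mem h]; simp; linarith
    · refine ⟨by norm_num, hC, (hr r).trans ?_⟩
      gcongr
      linarith
  | add x y ihx ihy =>
    obtain ⟨hax, hay, hne, hamp⟩ := hx
    obtain ⟨fx, px, qx, ex⟩ := ihx hax
    obtain ⟨fy, py, qy, ey⟩ := ihy hay
    refine ⟨(hrnd _).1, by simp only [amp]; positivity, hamp.trans hcC, ?_⟩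
    simp only [amp] at hamp
    simp only [flVal, flAdd, hrnd.eq_of_mem fx, hrnd.eq_of_mem fy, val, amp]
    refine abs_round_sub_le hr hε hC hCε (by linarith) (le_trans ?_ (hsum px py ex ey hne))
    rw [add_sub_add_comm]
    exact (abs_add_le _ _).trans (add_le_add ex ey)
  | sub x y ihx ihy =>
    obtain ⟨hax, hay, hne, hamp⟩ := hx
    obtain ⟨fx, px, qx, ex⟩ := ihx hax
    obtain ⟨fy, py, qy, ey⟩ := ihy hay
    refine ⟨(hrnd _).1, by simp only [amp]; positivity, hamp.trans hcC, ?_⟩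
    simp only [amp] at hamp
    simp only [flVal, flSub, hrnd.eq_of_mem fx, hrnd.eq_of_mem fy, val, amp]
    refine abs_round_sub_le hr hε hC hCε (by linarith) (le_trans ?_ (hsum px py ex ey hne))
    rw [sub_sub_sub_comm]
    exact (abs_sub _ _).trans (add_le_add ex ey)
  | mul x y ihx ihy =>
    obtain ⟨hax, hay, hamp⟩ := hx
    obtain ⟨fx, px, qx, ex⟩ := ihx hax
    obtain ⟨fy, py, qy, ey⟩ := ihy hay
    refine ⟨(hrnd _).1, by simp only [amp]; positivity, hamp.trans hcC, ?_⟩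
    simp only [amp] at hamp
    simp only [flVal, flMul, hrnd.eq_of_mem fx, hrnd.eq_of_mem fy, val, amp]
    refine abs_round_sub_le hr hε hC hCε (by linarith) ?_
    have hp := hprod px qx py qy
    set a := x.flVal rnd
    set b := y.flVal rnd
    have e : a * b - x.val * y.val
        = (a - x.val) * (b - y.val) + (a - x.val) * y.val + x.val * (b - y.val) := by ring
    have h1 : |a - x.val| * |b - y.val|
        ≤ (2 * ε * x.amp β * |x.val|) * (2 * ε * y.amp β * |y.val|) := by gcongr
    have h2 : |a - x.val| * |y.val| ≤ (2 * ε * x.amp β * |x.val|) * |y.val| := by gcongr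
    have h3 : |x.val| * |b - y.val| ≤ |x.val| * (2 * ε * y.amp β * |y.val|) := by gcongr
    have h4 := mul_le_mul_of_nonneg_right hp (by positivity : 0 ≤ |x.val| * |y.val|)
    have h5 : 0 ≤ ε * (|x.val| * |y.val|) := by positivity
    rw [e, abs_mul x.val y.val]
    refine (abs_add_three _ _ _).trans ?_
    rw [abs_mul, abs_mul, abs_mul]
    nlinarith
  | div x y ihx ihy =>
    obtain ⟨hax, hay, hne, hamp⟩ := hx
    obtain ⟨fx, px, qx, ex⟩ := ihx hax
    obtain ⟨fy, py, qy, ey⟩ := ihy hay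
    refine ⟨(hrnd _).1, by simp only [amp]; positivity, hamp.trans hcC, ?_⟩
    simp only [amp] at hamp
    simp only [flVal, flDiv, hrnd.eq_of_mem fx, hrnd.eq_of_mem fy, val, amp]
    refine abs_round_sub_le hr hε hC hCε (by linarith) ?_
    have hp := hprod px qx py qy
    have hp' := hprod py qy py qy
    have hy0 : 0 < |y.val| := abs_pos.2 hne
    have ht : 2 * ε * y.amp β ≤ 1 / 16 := by nlinarith
    set s := 2 * ε * x.amp β with hs
    set t := 2 * ε * y.amp β with ht'
    set a := x.flVal rnd
    set b := y.flVal rnd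
    have hb : (1 - t) * |y.val| ≤ |b| := by
      have := abs_sub_abs_le_abs_sub y.val b
      rw [abs_sub_comm] at this
      linarith
    have hb0 : 0 < |b| := lt_of_lt_of_le (by apply mul_pos _ hy0; linarith) hb
    have e : a / b - x.val / y.val
        = ((a - x.val) * y.val - x.val * (b - y.val)) / (b * y.val) := by
      rw [div_sub_div _ _ (abs_pos.1 hb0) hne]; congr 1; ring
    have h1 : |(a - x.val) * y.val - x.val * (b - y.val)| ≤ (s + t) * (|x.val| * |y.val|) := by
      refine (abs_sub _ _).trans ?_
      rw [abs_mul, abs_mul]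
      have h2 : |a - x.val| * |y.val| ≤ (s * |x.val|) * |y.val| := by gcongr
      have h3 : |x.val| * |b - y.val| ≤ |x.val| * (t * |y.val|) := by gcongr
      linarith
    have hst : s + t ≤ (s + t + ε / 2) * (1 - t) := by nlinarith
    have hs0 : 0 ≤ s := by positivity
    have ht0 : 0 ≤ t := by positivity
    rw [e, abs_div, abs_mul b, div_le_iff₀ (by positivity), abs_div]
    calc |(a - x.val) * y.val - x.val * (b - y.val)| ≤ (s + t) * (|x.val| * |y.val|) := h1
      _ ≤ (s + t + ε / 2) * (1 - t) * (|x.val| * |y.val|) := by gcongr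
      _ = (s + t + ε / 2) * |x.val| * ((1 - t) * |y.val|) := by ring
      _ ≤ (s + t + ε / 2) * |x.val| * |b| := by gcongr
      _ = (2 * ε * (x.amp β + y.amp β) + ε / 2) * (|x.val| / |y.val|) * (|b| * |y.val|) := by
        rw [hs, ht']; field_simp
  | sqrt x ihx =>
    obtain ⟨hax, h0, hamp⟩ := hx
    obtain ⟨fx, px, qx, ex⟩ := ihx hax
    refine ⟨(hrnd _).1, by simp only [amp]; positivity, hamp.trans hcC, ?_⟩
    simp only [amp] at hamp
    simp only [flVal, flSqrt, hrnd.eq_of_mem fx, val, amp]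
    refine abs_round_sub_le hr hε hC hCε (by linarith) ?_
    set a := x.flVal rnd
    rw [abs_of_nonneg h0] at ex
    have ht : 2 * ε * x.amp β ≤ 1 / 16 := by nlinarith
    have ha : 0 ≤ a := by nlinarith [(abs_le.1 ex).1]
    have hle : |√a - √x.val| ≤ 2 * ε * x.amp β * |√x.val| := by
      rw [abs_of_nonneg (Real.sqrt_nonneg x.val)]
      rcases h0.eq_or_lt with h | h
      · rw [← h] at ex ⊢
        have : a = 0 := by simpa using ex
        simp [this]
      · have hp : 0 < √x.val := Real.sqrt_pos.2 h
        have e : |√a - √x.val| * (√a + √x.val) = |a - x.val| := by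
          rw [← abs_of_nonneg (by positivity : 0 ≤ √a + √x.val), ← abs_mul]
          congr 1
          nlinarith [Real.sq_sqrt ha, Real.sq_sqrt h0]
        have e2 : |√a - √x.val| * √x.val ≤ 2 * ε * x.amp β * √x.val * √x.val := by
          rw [mul_assoc _ (√x.val), Real.mul_self_sqrt h0]
          refine le_trans ?_ ex
          rw [← e]
          gcongr
          linarith [Real.sqrt_nonneg a]
        exact le_of_mul_le_mul_right e2 hp
    refine hle.trans ?_
    gcongr
    linarith

/-! ### Accumulation of rounding errors in the final sum -/

lemma abs_round_add_sub_le {rnd : ℝ → ℝ} {ε a T E s S y y' z z' : ℝ}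
    (hr : ∀ x, |rnd x - x| ≤ ε * |x|) (hε : 0 < ε) (hε1 : 200 * ε ≤ 1) (ha : a ≤ 30)
    (hE : E ≤ a * (ε * T)) (hs : |s - S| ≤ E) (hy : |y' - y| ≤ 4 * ε * |y|)
    (hT : |S| + |y| ≤ T) (hz : |z - s| ≤ ε * |s|) (hz' : |z' - y'| ≤ ε * |y'|) :
    |rnd (z + z') - (S + y)| ≤ E + 4 * ε * T + 4 * ε * |y| := by
  have hS := abs_nonneg S
  have hy0 := abs_nonneg y
  have hT0 : 0 ≤ T := by linarith
  have h1 : |s| ≤ |S| + E := by have := abs_sub_abs_le_abs_sub s S; linarith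
  have h2 : |y'| ≤ |y| + 4 * ε * |y| := by have := abs_sub_abs_le_abs_sub y' y; linarith
  have hεT : 0 ≤ ε * T := by positivity
  have hyT : ε * |y| ≤ ε * T := by gcongr; linarith
  have hX : |s| + |y'| ≤ 6 / 5 * T := by nlinarith
  have h3 : |z + z' - (s + y')| ≤ ε * (6 / 5 * T) := by
    rw [add_sub_add_comm]
    refine (abs_add_le _ _).trans ((add_le_add hz hz').trans ?_)
    rw [← mul_add]
    gcongr
  have h4 : |s + y' - (S + y)| ≤ E + 4 * ε * |y| := by
    rw [add_sub_add_comm]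
    exact (abs_add_le _ _).trans (add_le_add hs hy)
  have h5 : |z + z'| ≤ 7 / 5 * T := by
    have h6 := abs_sub_abs_le_abs_sub (z + z') (s + y')
    have h7 := abs_add_le s y'
    nlinarith
  have h8 := hr (z + z')
  have h9 : ε * |z + z'| ≤ ε * (7 / 5 * T) := by gcongr
  have e : rnd (z + z') - (S + y)
      = (rnd (z + z') - (z + z')) + (z + z' - (s + y')) + (s + y' - (S + y)) := by ring
  rw [e]
  refine (abs_add_three _ _ _).trans ?_
  nlinarith

lemma abs_flAdd_sub_le {rnd : ℝ → ℝ} {ε a T E s S y y' : ℝ}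
    (hr : ∀ x, |rnd x - x| ≤ ε * |x|) (hε : 0 < ε) (hε1 : 200 * ε ≤ 1) (ha : a ≤ 30)
    (hE : E ≤ a * (ε * T)) (hs : |s - S| ≤ E) (hy : |y' - y| ≤ 4 * ε * |y|)
    (hT : |S| + |y| ≤ T) : |flAdd rnd s y' - (S + y)| ≤ E + 4 * ε * T + 4 * ε * |y| :=
  abs_round_add_sub_le hr hε hε1 ha hE hs hy hT (hr s) (hr y')

lemma abs_flSub_sub_le {rnd : ℝ → ℝ} {ε a T E s S y : ℝ}
    (hr : ∀ x, |rnd x - x| ≤ ε * |x|) (hε : 0 < ε) (hε1 : 200 * ε ≤ 1) (ha : a ≤ 30)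
    (hE : E ≤ a * (ε * T)) (hs : |s - S| ≤ E) (hT : |S| + |y| ≤ T) :
    |flSub rnd s y - (S - y)| ≤ E + 4 * ε * T + 4 * ε * |y| := by
  have h := abs_round_add_sub_le (y := -y) (y' := -y) (z := rnd s) (z' := -rnd y) hr hε hε1 ha hE hs
    (by rw [sub_self, abs_zero]; positivity) (by rwa [abs_neg]) (hr s)
    (by rw [abs_neg, ← neg_sub', abs_neg]; exact hr y)
  rwa [← sub_eq_add_neg, ← sub_eq_add_neg, abs_neg] at h

lemma abs_flMul_sub_le {rnd : ℝ → ℝ} {ε x y : ℝ} (hr : ∀ x, |rnd x - x| ≤ ε * |x|)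
    (hε : 0 < ε) (hε1 : 200 * ε ≤ 1) : |flMul rnd x y - x * y| ≤ 4 * ε * |x * y| := by
  have hx := hr x
  have hy := hr y
  have h0 : 0 ≤ |x * y| := abs_nonneg _
  have e : rnd x * rnd y - x * y = (rnd x - x) * (rnd y - y) + (rnd x - x) * y
      + x * (rnd y - y) := by ring
  have h1 : |rnd x * rnd y - x * y| ≤ 9 / 4 * ε * |x * y| := by
    rw [e]
    refine (abs_add_three _ _ _).trans ?_
    rw [abs_mul, abs_mul, abs_mul, abs_mul]
    have a1 : |rnd x - x| * |rnd y - y| ≤ (ε * |x|) * (ε * |y|) := by gcongr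
    have a2 : |rnd x - x| * |y| ≤ (ε * |x|) * |y| := by gcongr
    have a3 : |x| * |rnd y - y| ≤ |x| * (ε * |y|) := by gcongr
    have a4 : 0 ≤ ε * (|x| * |y|) := by positivity
    nlinarith
  have h2 : |rnd x * rnd y| ≤ 5 / 4 * |x * y| := by
    have := abs_sub_abs_le_abs_sub (rnd x * rnd y) (x * y)
    nlinarith
  have h3 := hr (rnd x * rnd y)
  have h4 : ε * |rnd x * rnd y| ≤ ε * (5 / 4 * |x * y|) := by gcongr
  have h5 := abs_sub_le (rnd (rnd x * rnd y)) (rnd x * rnd y) (x * y)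
  rw [flMul]
  nlinarith

/-- Total rounding error of the left-to-right evaluation: six additions of relative error `4ε`
with respect to the sum `T` of all magnitudes, and the errors of the terms themselves. -/
lemma abs_chain_sub_le {rnd : ℝ → ℝ} {ε T L₁ L₂ L₃ x P y Q H A : ℝ}
    (hr : ∀ x, |rnd x - x| ≤ ε * |x|) (hε : 0 < ε) (hε1 : 200 * ε ≤ 1)
    (hT : |L₁| + |L₂| + |L₃| + |x * P| + |y * Q| + |H| + |A| ≤ T) :
    |flSub rnd (flAdd rnd (flAdd rnd (flAdd rnd (flSub rnd (flSub rnd L₁ L₂) L₃)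
        (flMul rnd x P)) (flMul rnd y Q)) H) A
      - (L₁ - L₂ - L₃ + x * P + y * Q + H - A)| ≤ 28 * ε * T := by
  have n1 := abs_nonneg L₁
  have n2 := abs_nonneg L₂
  have n3 := abs_nonneg L₃
  have n4 := abs_nonneg (x * P)
  have n5 := abs_nonneg (y * Q)
  have n6 := abs_nonneg H
  have n7 := abs_nonneg A
  have b1 := abs_sub L₁ L₂
  have b2 := abs_sub (L₁ - L₂) L₃
  have b3 := abs_add_le (L₁ - L₂ - L₃) (x * P)
  have b4 := abs_add_le (L₁ - L₂ - L₃ + x * P) (y * Q)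
  have b5 := abs_add_le (L₁ - L₂ - L₃ + x * P + y * Q) H
  have hsum : ε * (|L₁| + |L₂| + |L₃| + |x * P| + |y * Q| + |H| + |A|) ≤ ε * T := by gcongr
  have m1 := mul_nonneg hε.le n1
  have m2 := mul_nonneg hε.le n2
  have m3 := mul_nonneg hε.le n3
  have m4 := mul_nonneg hε.le n4
  have m5 := mul_nonneg hε.le n5
  have m6 := mul_nonneg hε.le n6
  have m7 := mul_nonneg hε.le n7
  have mH : |H - H| ≤ 4 * ε * |H| := by rw [sub_self, abs_zero]; positivity
  have s1 := abs_flSub_sub_le (s := L₁) (S := L₁) (E := 0) (a := 0) (T := T) (y := L₂) hr hε hε1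
    (by norm_num) (by simp) (by simp) (by linarith)
  have s2 := abs_flSub_sub_le (a := 30) (T := T) (y := L₃) hr hε hε1
    (by norm_num) (by linarith) s1 (by linarith)
  have s3 := abs_flAdd_sub_le (a := 30) (T := T) hr hε hε1
    (by norm_num) (by linarith) s2 (abs_flMul_sub_le (x := x) (y := P) hr hε hε1) (by linarith)
  have s4 := abs_flAdd_sub_le (a := 30) (T := T) hr hε hε1
    (by norm_num) (by linarith) s3 (abs_flMul_sub_le (x := y) (y := Q) hr hε hε1) (by linarith)
  have s5 := abs_flAdd_sub_le (a := 30) (T := T) hr hε hε1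
    (by norm_num) (by linarith) s4 mH (by linarith)
  have s6 := abs_flSub_sub_le (a := 30) (T := T) (y := A) hr hε hε1
    (by norm_num) (by linarith) s5 (by linarith)
  refine s6.trans ?_
  linarith

/-! ### The Lanczos approximation -/

/-- The ratio of the Lanczos approximation to the factorial. -/
noncomputable def lanczosRatio (t : ℕ) (g : ℝ) (m : ℕ) : ℝ :=
  factLanczos t g m / (m.factorial : ℝ)

lemma abs_lanczosRatio_sub_one_le {t : ℕ} {g : ℝ} (hζ : lanczosError t g < 1 / 3) (m : ℕ) :
    |lanczosRatio t g m - 1| ≤ (lanczosError t g).toReal := by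
  have hm : (0 : ℝ) < m.factorial := by exact_mod_cast m.factorial_pos
  have h1 : ENNReal.ofReal (|(m.factorial : ℝ) - factLanczos t g m| / (m.factorial : ℝ))
      ≤ lanczosError t g := le_iSup (fun m : ℕ => ENNReal.ofReal
        (|(m.factorial : ℝ) - factLanczos t g m| / (m.factorial : ℝ))) m
  have h2 := (ENNReal.ofReal_le_iff_le_toReal (ne_top_of_lt hζ)).1 h1
  refine le_of_eq_of_le ?_ h2
  rw [lanczosRatio, div_sub_one hm.ne', abs_div, abs_of_pos hm, abs_sub_comm]

lemma toReal_lanczosError_lt {t : ℕ} {g : ℝ} (hζ : lanczosError t g < 1 / 3) :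
    (lanczosError t g).toReal < 1 / 3 := by
  have := ENNReal.toReal_strict_mono (by simp) hζ
  simpa using this

lemma lanczosRatio_pos {t : ℕ} {g : ℝ} (hζ : lanczosError t g < 1 / 3) (m : ℕ) :
    2 / 3 < lanczosRatio t g m := by
  have h1 := abs_le.1 (abs_lanczosRatio_sub_one_le hζ m)
  have h2 := toReal_lanczosError_lt hζ
  linarith

lemma lanczosSeries_pos {t : ℕ} {g : ℝ} (hg : 0 < g + 1 / 2) (hζ : lanczosError t g < 1 / 3)
    (m : ℕ) : 0 < lanczosSeries t g m := by
  have hm : (0 : ℝ) < m.factorial := by exact_mod_cast m.factorial_pos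
  have h := lanczosRatio_pos hζ m
  have h1 : 0 < factLanczos t g m := by
    have : 0 < lanczosRatio t g m := by linarith
    rw [lanczosRatio] at this
    exact (div_pos_iff_of_pos_right hm).1 this
  have hx : 0 < (m : ℝ) + g + 1 / 2 := by have := m.cast_nonneg (α := ℝ); linarith
  rw [factLanczos] at h1
  exact (mul_pos_iff_of_pos_left (by positivity)).1 h1

lemma log_factorial_add_log_lanczosRatio {t : ℕ} {g : ℝ} (hg : 0 < g + 1 / 2)
    (hζ : lanczosError t g < 1 / 3) (m : ℕ) :
    Real.log m.factorial + Real.log (lanczosRatio t g m)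
      = 1 / 2 * Real.log (2 * Real.pi) + ((m : ℝ) + 1 / 2) * Real.log ((m : ℝ) + g + 1 / 2)
        - ((m : ℝ) + g + 1 / 2) + Real.log (lanczosSeries t g m) := by
  have hm : (0 : ℝ) < m.factorial := by exact_mod_cast m.factorial_pos
  have h := lanczosRatio_pos hζ m
  have hA := lanczosSeries_pos hg hζ m
  have hx : 0 < (m : ℝ) + g + 1 / 2 := by have := m.cast_nonneg (α := ℝ); linarith
  rw [← Real.log_mul hm.ne' (by linarith), lanczosRatio, mul_div_cancel₀ _ hm.ne', factLanczos,
    Real.log_mul (by positivity) hA.ne', Real.log_mul (by positivity) (by positivity),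
    Real.log_mul (by positivity) (by positivity), Real.log_exp, Real.log_rpow hx,
    Real.log_sqrt (by positivity)]
  ring

lemma abs_logFactorial_sub_le {β t : ℕ} {g : ℝ} (hg : 0 < g + 1 / 2)
    (hζ : lanczosError t g < 1 / 3) (hβ : 5 ≤ β) (m : ℕ) :
    |logFactorial β t g m - (Real.log m.factorial + Real.log (lanczosRatio t g m))|
      ≤ (m + 2) * (8 * β * unitRoundoff β) := by
  have hm0 : (0 : ℝ) ≤ m := m.cast_nonneg
  have hx : 0 < (m : ℝ) + g + 1 / 2 := by linarith
  have h1 := abs_agmLog_sub_log_le hβ (by positivity : 0 < 2 * Real.pi)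
  have h2 := abs_agmLog_sub_log_le hβ hx
  have h3 := abs_agmLog_sub_log_le hβ (lanczosSeries_pos hg hζ m)
  rw [log_factorial_add_log_lanczosRatio hg hζ, logFactorial]
  set δ := 8 * β * unitRoundoff β
  have e : ∀ a a' b b' c c' d : ℝ, (1 / 2 * a + ((m : ℝ) + 1 / 2) * b - d + c)
      - (1 / 2 * a' + ((m : ℝ) + 1 / 2) * b' - d + c')
      = 1 / 2 * (a - a') + ((m : ℝ) + 1 / 2) * (b - b') + (c - c') := by intros; ring
  rw [e]
  refine (abs_add_three _ _ _).trans ?_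
  rw [abs_mul, abs_mul, abs_of_pos (by norm_num : (0 : ℝ) < 1 / 2),
    abs_of_pos (by positivity : 0 < (m : ℝ) + 1 / 2)]
  have : ((m : ℝ) + 1 / 2) * |agmLog β ((m : ℝ) + g + 1 / 2) - Real.log ((m : ℝ) + g + 1 / 2)|
      ≤ ((m : ℝ) + 1 / 2) * δ := by gcongr
  linarith

lemma abs_log_lanczosRatio_le {t : ℕ} {g : ℝ} (hζ : lanczosError t g < 1 / 3) (m : ℕ) :
    |Real.log (lanczosRatio t g m)| ≤ 1 := by
  have h := lanczosRatio_pos hζ m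
  have h1 := abs_le.1 (abs_lanczosRatio_sub_one_le hζ m)
  have h2 := toReal_lanczosError_lt hζ
  have h3 := Real.log_le_sub_one_of_pos (by linarith : 0 < lanczosRatio t g m)
  have h4 := Real.one_sub_inv_le_log_of_pos (by linarith : 0 < lanczosRatio t g m)
  have h5 : (lanczosRatio t g m)⁻¹ ≤ 3 / 2 := by
    rw [inv_le_comm₀ (by linarith) (by norm_num)]; linarith
  rw [abs_le]
  constructor <;> linarith

/-- The combined effect of three Lanczos approximations on the binomial coefficient. -/
lemma abs_lanczosRatio_div_sub_one_le {t : ℕ} {g : ℝ} (hζ : lanczosError t g < 1 / 3)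
    (n k j : ℕ) :
    |lanczosRatio t g n / (lanczosRatio t g k * lanczosRatio t g j) - 1|
      ≤ 6 * (lanczosError t g).toReal := by
  have a1 := lanczosRatio_pos hζ k
  have a2 := lanczosRatio_pos hζ j
  have b0 := abs_le.1 (abs_lanczosRatio_sub_one_le hζ n)
  have b1 := abs_le.1 (abs_lanczosRatio_sub_one_le hζ k)
  have b2 := abs_le.1 (abs_lanczosRatio_sub_one_le hζ j)
  have h2 := toReal_lanczosError_lt hζ
  set z := (lanczosError t g).toReal
  have hz : 0 ≤ z := ENNReal.toReal_nonneg
  set F := lanczosRatio t g n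
  set G := lanczosRatio t g k
  set H := lanczosRatio t g j
  have hGH : 0 < G * H := by apply mul_pos <;> linarith
  have hlo : (1 - z) * (1 - z) ≤ G * H := by
    apply mul_le_mul <;> linarith
  have hhi : G * H ≤ (1 + z) * (1 + z) := by
    apply mul_le_mul <;> linarith
  rw [div_sub_one hGH.ne', abs_div, abs_of_pos hGH, div_le_iff₀ hGH, abs_le]
  have hc : 6 * z * ((1 - z) * (1 - z)) ≤ 6 * z * (G * H) := by gcongr
  have hc2 : 4 / 9 ≤ G * H := by nlinarith
  have hc3 : 6 * z * (4 / 9) ≤ 6 * z * (G * H) := by gcongr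
  constructor
  -- `G H - F ≤ G H - (1 - z)` and `G H (1 - 6 z) ≤ 1 - z`
  · rcases le_total (1 - 6 * z) 0 with h | h
    · nlinarith
    · have : (1 - 6 * z) * (G * H) ≤ (1 - 6 * z) * ((1 + z) * (1 + z)) := by gcongr
      nlinarith [mul_nonneg hz hz]
  · nlinarith [mul_nonneg hz hz]

/-! ### Magnitudes of the terms -/

lemma log_le_of_two_mul_ceil_logb_le {β n : ℕ} (h : 2 * ⌈Real.logb 2 (n : ℝ)⌉ ≤ (β : ℤ)) :
    Real.log n ≤ β / 2 * Real.log 2 := by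
  have h1 : Real.logb 2 (n : ℝ) ≤ ⌈Real.logb 2 (n : ℝ)⌉ := Int.le_ceil _
  have h2 : (2 : ℝ) * ⌈Real.logb 2 (n : ℝ)⌉ ≤ β := by exact_mod_cast h
  have hl : 0 < Real.log 2 := Real.log_pos (by norm_num)
  rw [← div_le_iff₀ hl]
  exact h1.trans (by linarith)

lemma abs_log_le_of_ceil_neg_logb_le {β : ℕ} {p : ℝ} (hp : 0 < p) (hp1 : p < 1)
    (h : ⌈-Real.logb 2 p⌉ ≤ (β : ℤ)) : |Real.log p| ≤ β := by
  have h1 : -Real.logb 2 p ≤ ⌈-Real.logb 2 p⌉ := Int.le_ceil _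
  have h2 : (⌈-Real.logb 2 p⌉ : ℝ) ≤ β := by exact_mod_cast h
  have h3 := Real.log_neg hp hp1
  have hl : 0 < Real.log 2 := Real.log_pos (by norm_num)
  have h4 : -Real.log p = -Real.logb 2 p * Real.log 2 := by rw [Real.logb]; field_simp
  rw [abs_of_neg h3, h4]
  have hβ : (0 : ℝ) ≤ β := β.cast_nonneg
  have := Real.log_two_lt_d9
  calc -Real.logb 2 p * Real.log 2 ≤ β * Real.log 2 := by gcongr; linarith
    _ ≤ β := by nlinarith

lemma log_factorial_nonneg (m : ℕ) : 0 ≤ Real.log m.factorial :=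
  Real.log_nonneg (by exact_mod_cast m.factorial_pos)

lemma log_factorial_le {β n m : ℕ} (hmn : m ≤ n)
    (h : 2 * ⌈Real.logb 2 (n : ℝ)⌉ ≤ (β : ℤ)) : Real.log m.factorial ≤ m * (β / 2) := by
  rcases Nat.eq_zero_or_pos m with rfl | hm
  · simp
  have hm' : (0 : ℝ) < m := by exact_mod_cast hm
  have h1 : Real.log m.factorial ≤ m * Real.log m := by
    rw [← Real.log_pow]
    exact Real.log_le_log (by exact_mod_cast m.factorial_pos) (by exact_mod_cast m.factorial_le_pow)
  refine h1.trans ?_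
  gcongr
  have h2 : Real.log m ≤ Real.log n := Real.log_le_log hm' (by exact_mod_cast hmn)
  have h3 := log_le_of_two_mul_ceil_logb_le h
  have h4 := Real.log_two_lt_d9
  have hβ : (0 : ℝ) ≤ β := β.cast_nonneg
  nlinarith

/-- The size condition on `n` means `n ≤ ε ^ (-1/2)`. -/
lemma mul_unitRoundoff_le_sqrt {β n : ℕ} (h : 2 * ⌈Real.logb 2 (n : ℝ)⌉ ≤ (β : ℤ)) :
    n * unitRoundoff β ≤ √(unitRoundoff β) := by
  have hu := unitRoundoff_pos β
  rcases Nat.eq_zero_or_pos n with rfl | hn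
  · simp
  have hn' : (0 : ℝ) < n := by exact_mod_cast hn
  have h1 := log_le_of_two_mul_ceil_logb_le h
  have h2 : (n : ℝ) ^ 2 ≤ 2 ^ β := by
    rw [← Real.log_le_log_iff (by positivity) (by positivity), Real.log_pow, Real.log_pow]
    push_cast
    linarith
  refine Real.le_sqrt_of_sq_le ?_
  have h3 : (n : ℝ) ^ 2 * unitRoundoff β ≤ 1 := by
    rw [unitRoundoff, mul_one_div, div_le_one (by positivity)]; exact h2
  nlinarith

lemma binomialMass_pos {n k : ℕ} {p : ℝ} (hp : 0 < p) (hp1 : p < 1) (hk : k ≤ n) :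
    0 < binomialMass n p k := by
  have : 0 < n.choose k := Nat.choose_pos hk
  have h1 : 0 < 1 - p := by linarith
  unfold binomialMass
  positivity

lemma log_binomialMass {n k : ℕ} {p : ℝ} (hp : 0 < p) (hp1 : p < 1) (hk : k ≤ n) :
    Real.log (binomialMass n p k)
      = Real.log n.factorial - Real.log k.factorial - Real.log (n - k).factorial
        + k * Real.log p + ((n - k : ℕ) : ℝ) * Real.log (1 - p) := by
  have h1 : 0 < 1 - p := by linarith
  have f : ∀ m : ℕ, (m.factorial : ℝ) ≠ 0 := fun m => by exact_mod_cast m.factorial_ne_zero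
  have hc : (n.choose k : ℝ) ≠ 0 := by exact_mod_cast (Nat.choose_pos hk).ne'
  rw [binomialMass, Real.log_mul (mul_ne_zero hc (by positivity)) (by positivity),
    Real.log_mul hc (by positivity), Real.log_pow, Real.log_pow, Nat.cast_choose ℝ hk,
    Real.log_div (f n) (mul_ne_zero (f k) (f (n - k))), Real.log_mul (f k) (f (n - k))]
  ring

lemma neg_le_log_binomialMass {n k : ℕ} {p : ℝ} (hp : 0 < p) (hp1 : p < 1) (hk : k ≤ n) {B : ℝ}
    (h1 : |Real.log p| ≤ B) (h2 : |Real.log (1 - p)| ≤ B) :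
    -(n * B) ≤ Real.log (binomialMass n p k) := by
  have hq : 0 < 1 - p := by linarith
  have hc : (1 : ℝ) ≤ n.choose k := by exact_mod_cast Nat.choose_pos hk
  have e : Real.log (p ^ k * (1 - p) ^ (n - k)) ≤ Real.log (binomialMass n p k) := by
    refine Real.log_le_log (by positivity) ?_
    rw [binomialMass, mul_assoc]
    exact le_mul_of_one_le_left (by positivity) hc
  refine le_trans ?_ e
  rw [Real.log_mul (by positivity) (by positivity), Real.log_pow, Real.log_pow]
  have hn : (n : ℝ) = k + ((n - k : ℕ) : ℝ) := by
    rw [Nat.cast_sub hk]; ring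
  have a1 := mul_le_mul_of_nonneg_left (abs_le.1 h1).1 (k.cast_nonneg (α := ℝ))
  have a2 := mul_le_mul_of_nonneg_left (abs_le.1 h2).1 ((n - k).cast_nonneg (α := ℝ))
  rw [hn]
  linarith

lemma IsHat.pos {n k : ℕ} {p α : ℝ} {h : ℤ → ℝ} (hh : IsHat n p α h) (hp : 0 < p) (hp1 : p < 1)
    (hα : 0 < α) (hk : k ≤ n) : 0 < h k :=
  (mul_pos_iff_of_pos_left hα).1 ((binomialMass_pos hp hp1 hk).trans_le (hh.dominates k hk))

lemma IsHat.log_nonpos {n k : ℕ} {p α : ℝ} {h : ℤ → ℝ} (hh : IsHat n p α h) :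
    Real.log (h k) ≤ 0 :=
  Real.log_nonpos (hh.nonneg k) (le_hasSum hh.hasSum_one k fun i _ => hh.nonneg i)

lemma IsHat.neg_le_log {n k : ℕ} {p α : ℝ} {h : ℤ → ℝ} (hh : IsHat n p α h) (hp : 0 < p)
    (hp1 : p < 1) (hα : 0 < α) (hk : k ≤ n) {B : ℝ} (h1 : |Real.log p| ≤ B)
    (h2 : |Real.log (1 - p)| ≤ B) : -(n * B) - |Real.log α| ≤ Real.log (h k) := by
  have hb := Real.log_le_log (binomialMass_pos hp hp1 hk) (hh.dominates k hk)
  rw [Real.log_mul hα.ne' (hh.pos hp hp1 hα hk).ne'] at hb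
  have := neg_le_log_binomialMass hp hp1 hk h1 h2
  have := le_abs_self (Real.log α)
  linarith

/-- A relative error `d` perturbs the logarithm by at most `2d`. -/
lemma abs_log_sub_log_le {f v d : ℝ} (hv : 0 < v) (hd : d ≤ 1 / 2) (h : |f - v| ≤ d * v) :
    0 < f ∧ |Real.log f - Real.log v| ≤ 2 * d := by
  obtain ⟨h1, h2⟩ := abs_le.1 h
  have hd0 : 0 ≤ d := by
    have := (abs_nonneg _).trans h
    exact nonneg_of_mul_nonneg_left this hv
  have hf : 0 < f := by nlinarith
  refine ⟨hf, ?_⟩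
  rw [← Real.log_div hf.ne' hv.ne']
  have a1 : f / v ≤ 1 + d := by rw [div_le_iff₀ hv]; linarith
  have a2 : v / f ≤ 1 + 2 * d := by rw [div_le_iff₀ hf]; nlinarith
  have b1 := Real.log_le_sub_one_of_pos (by positivity : 0 < f / v)
  have b2 := Real.one_sub_inv_le_log_of_pos (by positivity : 0 < f / v)
  rw [inv_div] at b2
  rw [abs_le]
  constructor <;> linarith

/-! ### The error of the computed logarithm and of the rejection ratio -/

/-- The error of `l_v` as an approximation of the logarithm of the rejection ratio in which the
factorials are replaced by their Lanczos approximations. -/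
theorem abs_logComputedRatio_sub_le {β t n k : ℕ} {g p α c C : ℝ} {h : ℤ → ℝ} {rnd : ℝ → ℝ}
    {hinv : ArithExpr} (hg : 0 < g + 1 / 2) (hζ : lanczosError t g < 1 / 3) (hα : 0 < α)
    (hC : 1 ≤ C) (hcC : c ≤ C) (hβ : 8 ≤ β) (hCε : 32 * C ^ 2 * unitRoundoff β ≤ 1)
    (hβε : 8 * β * unitRoundoff β ≤ 1) (hαβ : |Real.log α| ≤ β) (hCβ : 4 * C ≤ β)
    (hp : 0 < p) (hp1 : p < 1) (hn : 2 * ⌈Real.logb 2 (n : ℝ)⌉ ≤ (β : ℤ))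
    (hpβ : ⌈-Real.logb 2 p⌉ ≤ (β : ℤ)) (hqβ : ⌈-Real.logb 2 (1 - p)⌉ ≤ (β : ℤ))
    (hh : IsHat n p α h) (hrnd : IsRoundToNearest β rnd) (hk : k ≤ n)
    (hval : hinv.val = 1 / h k) (hadm : hinv.Admissible β c) :
    |logComputedRatio β t g rnd n p α hinv k
      - (Real.log (rejectionRatio n p α h k) + Real.log (lanczosRatio t g n /
          (lanczosRatio t g k * lanczosRatio t g (n - k))))|
      ≤ (136 * (n : ℝ) + 177) * β * unitRoundoff β := by
  have hε := unitRoundoff_pos β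
  have hr := fun x => hrnd.abs_sub_le (by omega) x
  have hε1 : 200 * unitRoundoff β ≤ 1 := by
    have : (2 : ℝ) ^ 8 ≤ 2 ^ β := pow_le_pow_right₀ (by norm_num) hβ
    rw [unitRoundoff, mul_one_div, div_le_one (by positivity)]
    linarith
  have hβ5 : 5 ≤ β := by omega
  have hβ' : (8 : ℝ) ≤ β := by exact_mod_cast hβ
  have hq : 0 < 1 - p := by linarith
  have hhk := hh.pos hp hp1 hα hk
  have hlp := abs_log_le_of_ceil_neg_logb_le hp hp1 hpβ
  have hlq := abs_log_le_of_ceil_neg_logb_le hq (by linarith) hqβ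
  have hlh0 := hh.log_nonpos (k := k)
  have hlh1 := hh.neg_le_log hp hp1 hα hk hlp hlq
  have hv : 0 < hinv.val := by rw [hval]; positivity
  obtain ⟨-, hamp0, hampC, hfl⟩ :=
    hinv.abs_flVal_sub_val_le hrnd (by omega) hC hcC hCε hadm
  rw [abs_of_pos hv] at hfl
  have hCε' : 32 * C * unitRoundoff β ≤ 1 := by
    nlinarith [mul_pos (by linarith : 0 < C) hε]
  have hfl' : |hinv.flVal rnd - hinv.val| ≤ (2 * unitRoundoff β * C) * hinv.val :=
    hfl.trans (by gcongr)
  obtain ⟨hf0, hflog⟩ := abs_log_sub_log_le hv (by linarith) hfl'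
  have hlogval : Real.log hinv.val = -Real.log (h k) := by rw [hval, one_div, Real.log_inv]
  rw [hlogval] at hflog
  have dL := fun m => abs_logFactorial_sub_le hg hζ hβ5 m
  have dR := fun m => abs_log_lanczosRatio_le (t := t) (g := g) hζ m
  have dP := abs_agmLog_sub_log_le hβ5 hp
  have dQ := abs_agmLog_sub_log_le hβ5 hq
  have dH := abs_agmLog_sub_log_le hβ5 hf0
  have dA := abs_agmLog_sub_log_le hβ5 hα
  have hratio : Real.log (rejectionRatio n p α h k)
      + Real.log (lanczosRatio t g n / (lanczosRatio t g k * lanczosRatio t g (n - k)))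
      = (Real.log n.factorial + Real.log (lanczosRatio t g n))
        - (Real.log k.factorial + Real.log (lanczosRatio t g k))
        - (Real.log (n - k).factorial + Real.log (lanczosRatio t g (n - k)))
        + k * Real.log p + ((n - k : ℕ) : ℝ) * Real.log (1 - p) + (-Real.log (h k))
        - Real.log α := by
    have r0 : ∀ m, lanczosRatio t g m ≠ 0 := fun m => by
      have := lanczosRatio_pos (t := t) (g := g) hζ m
      linarith
    rw [rejectionRatio, Real.log_div (binomialMass_pos hp hp1 hk).ne' (by positivity),
      Real.log_mul hα.ne' hhk.ne', log_binomialMass hp hp1 hk,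
      Real.log_div (r0 n) (mul_ne_zero (r0 k) (r0 (n - k))), Real.log_mul (r0 k) (r0 (n - k))]
    ring
  rw [hratio]
  have fn := log_factorial_le le_rfl hn
  have fk := log_factorial_le hk hn
  have fj := log_factorial_le (n.sub_le k) hn
  have gn := log_factorial_nonneg n
  have gk := log_factorial_nonneg k
  have gj := log_factorial_nonneg (n - k)
  have hkj : (n : ℝ) = k + ((n - k : ℕ) : ℝ) := by rw [Nat.cast_sub hk]; ring
  have hk0 : (0 : ℝ) ≤ k := k.cast_nonneg
  have hj0 : (0 : ℝ) ≤ ((n - k : ℕ) : ℝ) := (n - k).cast_nonneg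
  simp only [logComputedRatio]
  set j : ℝ := ((n - k : ℕ) : ℝ) with hj
  set ε := unitRoundoff β with hεdef
  set δ := 8 * β * ε with hδ
  have hδ0 : 0 ≤ δ := by positivity
  -- magnitudes
  have tL : ∀ m : ℕ, |logFactorial β t g m| ≤ Real.log m.factorial + 1 + (m + 2) * δ := by
    intro m
    have h1 := dL m
    have h2 := abs_sub_abs_le_abs_sub (logFactorial β t g m)
      (Real.log m.factorial + Real.log (lanczosRatio t g m))
    have h3 := abs_add_le (Real.log m.factorial) (Real.log (lanczosRatio t g m))
    rw [abs_of_nonneg (log_factorial_nonneg m)] at h3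
    linarith [dR m]
  have tn := tL n
  have tk := tL k
  have tj := tL (n - k)
  rw [← hj] at tj
  have tP : |(k : ℝ) * agmLog β p| ≤ k * (β + 1) := by
    rw [abs_mul, abs_of_nonneg hk0]
    gcongr
    have := abs_sub_abs_le_abs_sub (agmLog β p) (Real.log p)
    linarith
  have tQ : |j * agmLog β (1 - p)| ≤ j * (β + 1) := by
    rw [abs_mul, abs_of_nonneg hj0]
    gcongr
    have := abs_sub_abs_le_abs_sub (agmLog β (1 - p)) (Real.log (1 - p))
    linarith
  have tH : |agmLog β (hinv.flVal rnd)| ≤ n * β + |Real.log α| + 2 := by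
    have h1 := abs_sub_abs_le_abs_sub (agmLog β (hinv.flVal rnd)) (Real.log (hinv.flVal rnd))
    have h2 := abs_sub_abs_le_abs_sub (Real.log (hinv.flVal rnd)) (-Real.log (h k))
    rw [abs_of_nonneg (by linarith : 0 ≤ -Real.log (h k))] at h2
    linarith
  have tA : |agmLog β α| ≤ |Real.log α| + 1 := by
    have := abs_sub_abs_le_abs_sub (agmLog β α) (Real.log α)
    linarith
  have hT := abs_chain_sub_le (L₁ := logFactorial β t g n) (L₂ := logFactorial β t g k)
    (L₃ := logFactorial β t g (n - k)) (x := k) (P := agmLog β p) (y := j)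
    (Q := agmLog β (1 - p)) (H := agmLog β (hinv.flVal rnd)) (A := agmLog β α)
    (T := 4 * ((n : ℝ) + 1) * β) hr hε hε1 (by
      have a1 : (k + 2) * δ ≤ (k + 2) * 1 := by gcongr
      have a2 : (j + 2) * δ ≤ (j + 2) * 1 := by gcongr
      have a3 : ((n : ℝ) + 2) * δ ≤ (n + 2) * 1 := by gcongr
      have a4 : k * (8 : ℝ) ≤ k * β := by gcongr
      have a5 : j * (8 : ℝ) ≤ j * β := by gcongr
      have a6 : (n : ℝ) * β = k * β + j * β := by rw [hkj]; ring
      linarith)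
  -- approximation errors of the terms
  have eP : |(k : ℝ) * agmLog β p - k * Real.log p| ≤ k * δ := by
    rw [← mul_sub, abs_mul, abs_of_nonneg hk0]
    gcongr
  have eQ : |j * agmLog β (1 - p) - j * Real.log (1 - p)| ≤ j * δ := by
    rw [← mul_sub, abs_mul, abs_of_nonneg hj0]
    gcongr
  have hCβε : 4 * C * ε ≤ β * ε := by gcongr
  have en := abs_le.1 (dL n)
  have ek := abs_le.1 (dL k)
  have ej := abs_le.1 (dL (n - k))
  rw [← hj] at ej
  have eP := abs_le.1 eP
  have eQ := abs_le.1 eQ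
  have eH := abs_le.1 dH
  have eF := abs_le.1 hflog
  have eA := abs_le.1 dA
  have eT := abs_le.1 hT
  have hgoal : (136 * (n : ℝ) + 177) * β * ε
      = 28 * ε * (4 * ((n : ℝ) + 1) * β) + ((3 * (n : ℝ) + 8) * δ + β * ε) := by
    rw [hδ]; ring
  have hnδ : (n : ℝ) * δ = k * δ + j * δ := by rw [hkj]; ring
  rw [hgoal, abs_le]
  constructor <;> linarith [eT.1, eT.2, en.1, en.2, ek.1, ek.2, ej.1, ej.2, eP.1, eP.2, eQ.1,
    eQ.2, eH.1, eH.2, eF.1, eF.2, eA.1, eA.2]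

/-- The conditions on the working precision. The last one makes the error of the logarithm small
uniformly in `n`, since `n ε ≤ √ε`. -/
lemma eventually_precision (α C : ℝ) :
    ∀ᶠ β : ℕ in atTop, 8 ≤ β ∧ 32 * C ^ 2 * unitRoundoff β ≤ 1 ∧ |Real.log α| ≤ β ∧
      4 * C ≤ β ∧ 400 * (β * √(unitRoundoff β)) ≤ 1 := by
  have hu : ∀ β : ℕ, unitRoundoff β = (1 / 2 : ℝ) ^ β := fun β => by
    rw [unitRoundoff, one_div_pow]
  have h1 : Tendsto (fun β : ℕ => 32 * C ^ 2 * unitRoundoff β) atTop (𝓝 (32 * C ^ 2 * 0)) := by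
    simp only [hu]
    exact (tendsto_pow_atTop_nhds_zero_of_lt_one (by norm_num) (by norm_num)).const_mul _
  have h2 : Tendsto (fun β : ℕ => 400 * (β * √(unitRoundoff β))) atTop (𝓝 (400 * 0)) := by
    have e : ∀ β : ℕ, √(unitRoundoff β) = √(1 / 2) ^ β := fun β => by
      rw [Real.sqrt_eq_iff_mul_self_eq (unitRoundoff_pos β).le (by positivity), ← mul_pow,
        Real.mul_self_sqrt (by norm_num), hu]
    simp only [e]
    refine (tendsto_self_mul_const_pow_of_lt_one (by positivity) ?_).const_mul _
    rw [Real.sqrt_lt' one_pos]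
    norm_num
  rw [mul_zero] at h1 h2
  filter_upwards [eventually_ge_atTop 8, h1.eventually_le_const one_pos,
    tendsto_natCast_atTop_atTop.eventually_ge_atTop |Real.log α|,
    tendsto_natCast_atTop_atTop.eventually_ge_atTop (4 * C),
    h2.eventually_le_const one_pos] with β a b c d e
  exact ⟨a, b, c, d, e⟩

end BinSamp

theorem mainTheorem2 (t : ℕ) (g : ℝ) (hg : 0 < g + 1 / 2)
    (hζ : BinSamp.lanczosError t g < 1 / 3) (α c : ℝ) (hα : 0 < α) (hc : 0 < c) :
    ∃ R : ℕ → ℝ, Asymptotics.IsLittleO Filter.atTop R BinSamp.unitRoundoff ∧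
      ∀ᶠ β : ℕ in Filter.atTop,
        ∀ (n : ℕ) (p : ℝ) (h : ℤ → ℝ) (rnd : ℝ → ℝ),
          0 < p → p < 1 →
          2 * ⌈Real.logb 2 (n : ℝ)⌉ ≤ (β : ℤ) →
          ⌈-Real.logb 2 p⌉ ≤ (β : ℤ) →
          ⌈-Real.logb 2 (1 - p)⌉ ≤ (β : ℤ) →
          BinSamp.IsHat n p α h →
          BinSamp.IsRoundToNearest β rnd →
          ∀ k : ℕ, k ≤ n →
            ∀ hinv : BinSamp.ArithExpr, hinv.val = 1 / h k → hinv.Admissible β c →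
              |BinSamp.computedRatio β t g rnd n p α hinv k
                  / BinSamp.rejectionRatio n p α h k - 1| ≤
                (1110 * (n : ℝ) + 2540) * β * BinSamp.unitRoundoff β
                  + 14 * BinSamp.unitRoundoff β * Real.log (h k)
                  + 15 * (BinSamp.lanczosError t g).toReal + R β := by
  -- All errors of higher order fit into the slack of the constants, so that no remainder is left.
  refine ⟨0, Asymptotics.isLittleO_zero _ _, ?_⟩
  filter_upwards [BinSamp.eventually_precision α (max 1 c)] with β hβ
  obtain ⟨hβ8, hCε, hαβ, hCβ, hsqrt⟩ := hβ
  intro n p h rnd hp hp1 hn hpβ hqβ hh hrnd k hk hinv hval hadm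
  have hε := BinSamp.unitRoundoff_pos β
  have hβ' : (8 : ℝ) ≤ β := by exact_mod_cast hβ8
  have hn0 : (0 : ℝ) ≤ n := n.cast_nonneg
  have hnε := BinSamp.mul_unitRoundoff_le_sqrt hn
  have hlp := BinSamp.abs_log_le_of_ceil_neg_logb_le hp hp1 hpβ
  have hlq := BinSamp.abs_log_le_of_ceil_neg_logb_le (by linarith) (by linarith) hqβ
  have hlh := hh.neg_le_log hp hp1 hα hk hlp hlq
  have hr0 : 0 < BinSamp.rejectionRatio n p α h k :=
    div_pos (BinSamp.binomialMass_pos hp hp1 hk) (mul_pos hα (hh.pos hp hp1 hα hk))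
  have hεs : BinSamp.unitRoundoff β ≤ √(BinSamp.unitRoundoff β) := by
    refine Real.le_sqrt_of_sq_le ?_
    have : BinSamp.unitRoundoff β ≤ 1 := by
      rw [BinSamp.unitRoundoff]
      exact div_le_one_of_le₀ (one_le_pow₀ (by norm_num)) (by positivity)
    nlinarith
  have hβε : β * BinSamp.unitRoundoff β ≤ β * √(BinSamp.unitRoundoff β) := by gcongr
  have hmain := BinSamp.abs_logComputedRatio_sub_le hg hζ hα (le_max_left 1 c) (le_max_right 1 c)
    hβ8 hCε (by linarith) hαβ hCβ hp hp1 hn hpβ hqβ hh hrnd hk hval hadm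
  have hE := BinSamp.abs_lanczosRatio_div_sub_one_le hζ n k (n - k)
  have hEpos : 0 < BinSamp.lanczosRatio t g n
      / (BinSamp.lanczosRatio t g k * BinSamp.lanczosRatio t g (n - k)) := by
    have q := fun m => BinSamp.lanczosRatio_pos (t := t) (g := g) hζ m
    exact div_pos (by linarith [q n]) (mul_pos (by linarith [q k]) (by linarith [q (n - k)]))
  have hz := BinSamp.toReal_lanczosError_lt hζ
  have hz0 : 0 ≤ (BinSamp.lanczosError t g).toReal := ENNReal.toReal_nonneg
  rw [BinSamp.computedRatio]
  set E := BinSamp.lanczosRatio t g n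
      / (BinSamp.lanczosRatio t g k * BinSamp.lanczosRatio t g (n - k))
  set r := BinSamp.rejectionRatio n p α h k
  set ε := BinSamp.unitRoundoff β
  set D := BinSamp.logComputedRatio β t g rnd n p α hinv k - (Real.log r + Real.log E) with hD
  have hsplit : Real.exp (BinSamp.logComputedRatio β t g rnd n p α hinv k) / r
      = Real.exp D * E := by
    have : BinSamp.logComputedRatio β t g rnd n p α hinv k = D + (Real.log r + Real.log E) := by
      rw [hD]; ring
    rw [this, Real.exp_add, Real.exp_add, Real.exp_log hr0, Real.exp_log hEpos]
    field_simp
  have hD1 : |D| ≤ 1 := by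
    refine hmain.trans ?_
    have : β * (n * ε) ≤ β * √ε := by gcongr
    nlinarith
  have hexp := Real.abs_exp_sub_one_le hD1
  have hE3 : E ≤ 3 := by linarith [(abs_le.1 hE).2]
  have hfin : |Real.exp D * E - 1| ≤ 6 * |D| + 6 * (BinSamp.lanczosError t g).toReal := by
    have e : Real.exp D * E - 1 = (Real.exp D - 1) * E + (E - 1) := by ring
    rw [e]
    refine (abs_add_le _ _).trans (add_le_add ?_ hE)
    rw [abs_mul, abs_of_pos hEpos]
    calc |Real.exp D - 1| * E ≤ (2 * |D|) * 3 := by gcongr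
      _ = _ := by ring
  have hlogh : -(14 * ((n : ℝ) + 1) * β * ε) ≤ 14 * ε * Real.log (h k) := by
    have : 14 * ε * (-(n * β) - β) ≤ 14 * ε * Real.log (h k) := by
      gcongr
      linarith
    linarith
  have hpos : 0 ≤ (n : ℝ) * β * ε := by positivity
  have hpos' : 0 ≤ (β : ℝ) * ε := by positivity
  rw [hsplit, Pi.zero_apply]
  refine hfin.trans ?_
  linarith
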